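/- Let $\mathcal X\subset\mathbb R^d$ be bounded with $L_2$-diameter $D$, and let $\mathcal Y$ be a finite label set. There are constants $C>0$ and $s>2$, depending only on $\mathcal X$ and $\mathcal Y$, such that the following holds. Let $\mathcal S_1,\dots,\mathcal S_T$ (sources) and $\mathcal T$ (target) be probability laws on $\mathcal X\times\mathcal Y$ with $\mathcal T(y)=0$ whenever $\mathcal S_t(y)=0$ for some $t$, and put $\alpha_t(y)=\mathcal T(y)/\mathcal S_t(y)$ (with $0/0=0$), $d^{\sup}_\infty=\max_{t,y}\alpha_t(y)$, $\mathcal Y_+=\{y:\mathcal T(y)>0\}$. Let $\ell:\mathbb R\to[0,L_{\max}]$ be $L$-Lipschitz, and let $\mathcal H$ be a family of functions $h:\mathcal X\times\mathcal Y\to\mathbb R$ such that $h(\cdot,y)$ is $K$-Lipschitz for every $y$. Write $R_{\mathcal T}(h)=\mathbb E_{(x,y)\sim\mathcal T}\,\ell(h(x,y))$. Let $\hat{\mathcal S}_t$ ($t=1,\dots,T$) and $\hat{\mathcal T}$ be independent samples of $N_{\mathcal S_t}\ge1$ and $N_{\mathcal T}\ge1$ i.i.d. draws from $\mathcal S_t$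 and $\mathcal T$. Let $N^y_{\mathcal S_t}$, $N^y_{\mathcal T}$ be the numbers of sample points with label $y$, $\hat{\mathcal T}(y)=N^y_{\mathcal T}/N_{\mathcal T}$, and let $\hat{\mathcal S}_t(x|Y=y)$, $\hat{\mathcal T}(x|Y=y)$ be the uniform laws on the sample points with label $y$. Put $N=\sum_tN_{\mathcal S_t}$, $\beta_t=N_{\mathcal S_t}/N$ and $\hat R^{a}_{\mathcal S_t}(h)=\frac1{N_{\mathcal S_t}}\sum_{(x_i,y_i)\in\hat{\mathcal S}_t}a(y_i)\ell(h(x_i,y_i))$. Let $W_1$ be the Wasserstein-1 distance with the $L_2$-distance as cost. Let $0<\delta<1$ and let $\boldsymbol\lambda$ be a vector with $\boldsymbol\lambda[t]\ge0$, $\sum_t\boldsymbol\lambda[t]=1$. Then with probability at least $1-4\delta$, simultaneously for all $h\in\mathcal H$ and all $\hat\alpha_1,\dots,\hat\alpha_T:\mathcal Y\to\mathbb R$ (in particular for any estimates computed from the data, such as the empirical label ratios), $$ \begin{aligned} R_{\mathcal T}(h)\le{}&\sum_t\boldsymbol\lambda[t]\hat R^{\hat\alpha_t}_{\mathcal S_t}(h)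 +L_{\max}d^{\sup}_\infty\sqrt{\sum_{t=1}^T\frac{\boldsymbol\lambda[t]^2}{\beta_t}}\sqrt{\frac{\log(1/\delta)}{2N}}\\ &+LK\sum_t\boldsymbol\lambda[t]\,\mathbb E_{y\sim\hat{\mathcal T}(y)}W_1\big(\hat{\mathcal T}(x|Y=y)\,\|\,\hat{\mathcal S}_t(x|Y=y)\big) +L_{\max}\sup_t\|\alpha_t-\hat\alpha_t\|_2+\mathrm{Comp}, \end{aligned} $$ where $$ \mathrm{Comp}=2\sup_t\mathcal R_t+LK\Big[\sup_{t,\;y\in\mathcal Y_+}\kappa_{t,y}+C_{\max}\Big(\sqrt{\tfrac{2\log(2|\mathcal Y|)}{N_{\mathcal T}}}+\sqrt{\tfrac{\log(T/\delta)}{2N_{\mathcal T}}}\Big)\Big], $$ $\mathcal R_t=\mathbb E_{\hat{\mathcal S}_t}\mathbb E_\sigma\sup_{h\in\mathcal H}\frac1{N_{\mathcal S_t}}\sum_i\sigma_i\alpha_t(y_i)\ell(h(x_i,y_i))$ is the Rademacher complexity ($\sigma_i$ independent uniform signs), $$ \kappa_{t,y}=C(N^y_{\mathcal S_t})^{-1/s}+C(N^y_{\mathcal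 T})^{-1/s}+D\sqrt{\tfrac12\log\tfrac{2T|\mathcal Y|}{\delta}}\Big(\sqrt{\tfrac1{N^y_{\mathcal S_t}}}+\sqrt{\tfrac1{N^y_{\mathcal T}}}\Big), $$ and $C_{\max}=\sup_{t,\;y\in\mathcal Y_+}W_1(\hat{\mathcal T}(x|Y=y)\|\hat{\mathcal S}_t(x|Y=y))$. If a label $y\in\mathcal Y_+$ is missing from one of the samples, $\kappa$ is read as $+\infty$ and the bound says nothing. Moreover, for fixed $\mathcal S_t,\mathcal T,\ell,\mathcal H,\delta$ and a fixed value $C_{\max}\ge0$, $\mathrm{Comp}$ is a non-increasing function of the sample sizes $N_{\mathcal S_t}\ge1$, $N_{\mathcal T}\ge1$ and the class counts $N^y_{\mathcal S_t}$, $N^y_{\mathcal T}$ (those with $y\in\mathcal Y_+$ being at least $1$). -/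

import Mathlib

open MeasureTheory
open scoped ENNReal NNReal

noncomputable section

namespace LabelShift

/-- The probability that a law on `X × Y` gives to the label `y`, written `D(y)`. -/
def labelMass {X Y : Type*} [MeasurableSpace X] [MeasurableSpace Y]
    (D : Measure (X × Y)) (y : Y) : ℝ :=
  D.real {p | p.2 = y}

/-- The true label-distribution ratio `α(y) = Q(y) / S(y)` of target `Q` and source `S`. -/
def labelRatio {X Y : Type*} [MeasurableSpace X] [MeasurableSpace Y]
    (S Q : Measure (X × Y)) (y : Y) : ℝ :=
  labelMass Q y / labelMass S y

/-- The expected risk `R_D(h) = E_{(x,y) ∼ D} ℓ(h(x,y))`. -/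
def risk {X Y : Type*} [MeasurableSpace X] [MeasurableSpace Y]
    (D : Measure (X × Y)) (ℓ : ℝ → ℝ) (h : X → Y → ℝ) : ℝ :=
  ∫ p, ℓ (h p.1 p.2) ∂D

/-- The empirical `a`-weighted risk `(1/n) ∑ a(yᵢ) ℓ(h(xᵢ,yᵢ))` of the sample `z`. -/
def empRisk {X Y : Type*} {n : ℕ} (z : Fin n → X × Y) (a : Y → ℝ)
    (ℓ : ℝ → ℝ) (h : X → Y → ℝ) : ℝ :=
  (1 / (n : ℝ)) * ∑ i, a (z i).2 * ℓ (h (z i).1 (z i).2)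

/-- The number of points of the sample `z` whose label is `y`. -/
def classCount {X Y : Type*} [DecidableEq Y] {n : ℕ} (z : Fin n → X × Y) (y : Y) : ℕ :=
  (Finset.univ.filter fun i => (z i).2 = y).card

/-- The empirical conditional law of `x` given `Y = y`: the uniform law on the points of the
sample `z` that carry the label `y`. (It is the zero measure if there is no such point.) -/
def empCond {X Y : Type*} [MeasurableSpace X] [DecidableEq Y] {n : ℕ}
    (z : Fin n → X × Y) (y : Y) : Measure X :=
  ((classCount z y : ℝ≥0∞))⁻¹ •
    ∑ i ∈ Finset.univ.filter (fun i => (z i).2 = y), Measure.dirac (z i).1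

/-- The Wasserstein-1 distance with the distance of `X` as cost: the infimum of
`∫ dist(x, x') dγ` over all couplings `γ` of `μ` and `ν`. -/
def wasserstein1 {X : Type*} [MetricSpace X] [MeasurableSpace X] (μ ν : Measure X) : ℝ≥0∞ :=
  ⨅ γ ∈ {γ : Measure (X × X) | γ.map Prod.fst = μ ∧ γ.map Prod.snd = ν},
    ∫⁻ p, edist p.1 p.2 ∂γ

/-- `W₁` between the empirical class-`y` conditionals of a target sample and a source sample. -/
def empW1 {X Y : Type*} [MetricSpace X] [MeasurableSpace X] [DecidableEq Y] {n m : ℕ}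
    (zQ : Fin m → X × Y) (zS : Fin n → X × Y) (y : Y) : ℝ :=
  (wasserstein1 (empCond zQ y) (empCond zS y)).toReal

/-- The Rademacher complexity, for samples of size `n` from `S`, of the weighted losses
`(x,y) ↦ a(y) ℓ(h(x,y))`, `h ∈ H`:
`E_{z ∼ Sⁿ} E_σ sup_{h ∈ H} (1/n) ∑ σᵢ a(yᵢ) ℓ(h(xᵢ,yᵢ))`, with `σ` uniform on `{-1,1}ⁿ`. -/
def rademacher {X Y : Type*} [MeasurableSpace X] [MeasurableSpace Y]
    (S : Measure (X × Y)) (a : Y → ℝ) (ℓ : ℝ → ℝ) (H : Set (X → Y → ℝ)) (n : ℕ) : ℝ :=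
  ∫ z, (1 / 2 ^ n : ℝ) * ∑ σ : Fin n → Bool,
      ⨆ h : H, (1 / (n : ℝ)) * ∑ i, (if σ i then (1 : ℝ) else -1) *
        (a (z i).2 * ℓ (h.1 (z i).1 (z i).2))
    ∂(Measure.pi fun _ : Fin n => S)

/-- `κ` for one source and one label: the deviation of the empirical from the true conditional
laws in `W₁`, with `k` source points and `m` target points of that label, number of sources `T`,
number of labels `c`, diameter `D` of the input space, and constants `C`, `s`. -/
def kappa (C s D : ℝ) (T c : ℕ) (δ : ℝ) (k m : ℕ) : ℝ :=
  C * (k : ℝ) ^ (-(1 / s)) + C * (m : ℝ) ^ (-(1 / s)) +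
    D * √((1 / 2) * Real.log (2 * T * c / δ)) * (√(1 / (k : ℝ)) + √(1 / (m : ℝ)))

/-- The term `Comp`. Here `LK` is the product of the two Lipschitz constants, `N t` and `M` are the
sizes of the samples from source `t` and from the target, `k t y` and `m y` are the numbers of
points with label `y` in them. Labels that have probability zero under the target play no role. -/
def comp {X Y : Type*} [MeasurableSpace X] [MeasurableSpace Y] [Fintype Y] {T : ℕ}
    (S : Fin T → Measure (X × Y)) (Q : Measure (X × Y)) (ℓ : ℝ → ℝ) (H : Set (X → Y → ℝ))
    (LK C s D Cmax : ℝ) (N : Fin T → ℕ) (M : ℕ) (k : Fin T → Y → ℕ) (m : Y → ℕ) (δ : ℝ) : ℝ :=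
  2 * (⨆ t, rademacher (S t) (labelRatio (S t) Q) ℓ H (N t)) +
    LK * ((⨆ p : Fin T × {y : Y // 0 < labelMass Q y},
        kappa C s D T (Fintype.card Y) δ (k p.1 p.2) (m p.2)) +
      Cmax * (√(2 * Real.log (2 * Fintype.card Y) / M) + √(Real.log (T / δ) / (2 * M))))

/-- The largest empirical `W₁` distance between target and source class conditionals. -/
def maxEmpW1 {X Y : Type*} [MetricSpace X] [MeasurableSpace X] [MeasurableSpace Y]
    [DecidableEq Y] {T : ℕ} {N : Fin T → ℕ} {M : ℕ} (Q : Measure (X × Y))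
    (zS : ∀ t, Fin (N t) → X × Y) (zQ : Fin M → X × Y) : ℝ :=
  ⨆ p : Fin T × {y : Y // 0 < labelMass Q y}, empW1 zQ (zS p.1) p.2

/-- The joint law of the data: all samples are independent, the `t`-th one consists of `N t`
i.i.d. draws from `S t` and the last one of `M` i.i.d. draws from `Q`. -/
def dataLaw {X Y : Type*} [MeasurableSpace X] [MeasurableSpace Y] {T : ℕ}
    (S : Fin T → Measure (X × Y)) (Q : Measure (X × Y)) (N : Fin T → ℕ) (M : ℕ) :
    Measure ((∀ t, Fin (N t) → X × Y) × (Fin M → X × Y)) :=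
  (Measure.pi fun t => Measure.pi fun _ : Fin (N t) => S t).prod
    (Measure.pi fun _ : Fin M => Q)

end LabelShift

end

/-
For each source the loss reweighted by the label ratios `α_t = Q(y) / S_t(y)` has, over the samples
from `S_t`, an expectation in which the labels follow the target law; hence it differs from the
target risk only by an average over `y ∼ Q` of differences of the class conditionals, integrated
against a Lipschitz function. The `λ`-mixture of the reweighted empirical risks concentrates around
its mean by McDiarmid's inequality and symmetrization, all sources together, which produces the
factor `√(∑ λ_t² / β_t)`.

The easy half of Kantorovich duality bounds the difference of the empirical class conditionals by
`W₁`. Conditionally on the labels, each empirical conditional is a sample mean of i.i.d. points; its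
deviation from the true conditional over all Lipschitz functions has mean `O(n^{-1/s})`, because
polynomial coverings allow quantization at scale `n^{-1/s}`, and it concentrates by McDiarmid again.

Replacing the label law of the target by the label frequencies costs their `ℓ¹` deviation, weighted
by the empirical distances, hence by `C_max`. The fluctuation of that deviation is paid for by
`√(log(T / δ) / (2 N_T))`; its mean, `O(N_T^{-1/2})`, is absorbed into `κ` by enlarging `C`, since
`C_max` is at most the diameter.
-/

noncomputable section

namespace LabelShift

open ProbabilityTheory

lemma integral_comp_of_measurePreserving {V W : Type*} [MeasurableSpace V] [MeasurableSpace W]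
    {μ : Measure V} {ν : Measure W} {φ : V → W} (hφ : MeasurePreserving φ μ ν) {f : W → ℝ}
    (hf : AEStronglyMeasurable f ν) : ∫ x, f (φ x) ∂μ = ∫ y, f y ∂ν := by
  rw [← hφ.map_eq] at hf ⊢
  rw [integral_map hφ.aemeasurable hf]

lemma abs_integral_le_of_abs_le {W : Type*} [MeasurableSpace W] (ν : Measure W)
    [IsProbabilityMeasure ν] {f : W → ℝ} {b : ℝ} (hf : ∀ p, |f p| ≤ b) : |∫ p, f p ∂ν| ≤ b := by
  simpa using norm_integral_le_of_norm_le_const (μ := ν) (f := f) (C := b) (ae_of_all _ hf)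

section Concentration

lemma measureReal_sqrt_lt_le_of_hasSubgaussianMGF {Ω : Type*} [MeasurableSpace Ω] {μ : Measure Ω}
    [IsProbabilityMeasure μ] {f : Ω → ℝ} {c : ℝ≥0} (h : HasSubgaussianMGF f c μ) {δ : ℝ}
    (hδ : 0 < δ) : μ.real {ω | √(2 * c * Real.log (1 / δ)) < f ω} ≤ δ := by
  rcases le_total 1 δ with hδ1 | hδ1
  · exact measureReal_le_one.trans hδ1
  rcases eq_or_ne c 0 with rfl | hc
  · have hzero : μ {ω | √(2 * (0 : ℝ≥0) * Real.log (1 / δ)) < f ω} = 0 := by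
      refine measure_eq_zero_iff_ae_notMem.2 ?_
      filter_upwards [h.ae_eq_zero_of_hasSubgaussianMGF_zero] with ω hω
      simp [hω]
    exact ((measureReal_eq_zero_iff).2 hzero).trans_le hδ.le
  · have hlog : 0 ≤ Real.log (1 / δ) := Real.log_nonneg (one_le_one_div hδ hδ1)
    calc μ.real {ω | √(2 * c * Real.log (1 / δ)) < f ω}
        ≤ μ.real {ω | √(2 * c * Real.log (1 / δ)) ≤ f ω} :=
          measureReal_mono (Set.ofPred_subset_ofPred.2 fun _ => le_of_lt)
      _ ≤ Real.exp (-√(2 * c * Real.log (1 / δ)) ^ 2 / (2 * c)) :=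
          h.measure_ge_le (Real.sqrt_nonneg _)
      _ = δ := by
          rw [Real.sq_sqrt (by positivity), neg_div, mul_div_cancel_left₀ _ (by positivity),
            one_div, Real.log_inv, neg_neg, Real.exp_log hδ]

lemma hasSubgaussianMGF_sub_integral_of_sub_le {A : Type*} [MeasurableSpace A] {μ : Measure A}
    [IsProbabilityMeasure μ] {f : A → ℝ} (hf : AEMeasurable f μ) {c : ℝ≥0}
    (hc : ∀ x x', f x - f x' ≤ c) :
    HasSubgaussianMGF (fun x => f x - ∫ x, f x ∂μ) ((c / 2) ^ 2) μ := by
  have := nonempty_of_isProbabilityMeasure μ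
  have hbdd : BddBelow (Set.range f) :=
    ⟨f Classical.ofNonempty - c, Set.forall_mem_range.2 fun x => sub_le_comm.1 (hc _ x)⟩
  have hmem : ∀ x, f x ∈ Set.Icc (⨅ x, f x) ((⨅ x, f x) + c) := fun x =>
    ⟨ciInf_le hbdd x, sub_le_iff_le_add.1 (le_ciInf fun x' => sub_le_comm.1 (hc x x'))⟩
  simpa using hasSubgaussianMGF_of_mem_Icc hf (ae_of_all μ hmem)

lemma hasSubgaussianMGF_prod {A B : Type*} [MeasurableSpace A] [MeasurableSpace B]
    (μ : Measure A) (ν : Measure B) [IsProbabilityMeasure μ] [IsProbabilityMeasure ν]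
    {F : A × B → ℝ} (hF : Measurable F) {b : ℝ} (hb : ∀ p, |F p| ≤ b) {c C : ℝ≥0}
    (hc : ∀ x x' w, F (x, w) - F (x', w) ≤ c)
    (h : HasSubgaussianMGF (fun w => (∫ x, F (x, w) ∂μ) - ∫ w, ∫ x, F (x, w) ∂μ ∂ν) C ν) :
    HasSubgaussianMGF (fun p => F p - ∫ p, F p ∂(μ.prod ν)) ((c / 2) ^ 2 + C) (μ.prod ν) := by
  rw [← integral_prod_symm F (Integrable.of_bound hF.aestronglyMeasurable b (ae_of_all _ hb))] at h
  set m := ∫ p, F p ∂(μ.prod ν)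
  have hint : ∀ t : ℝ, Integrable (fun p => Real.exp (t * (F p - m))) (μ.prod ν) := fun t =>
    integrable_exp_mul_of_mem_Icc (a := -b - m) (b := b - m) (by fun_prop)
      (ae_of_all _ fun p => ⟨by linarith [abs_le.1 (hb p)], by linarith [abs_le.1 (hb p)]⟩)
  refine ⟨hint, fun t => ?_⟩
  have hsection : ∀ w, ∫ x, Real.exp (t * (F (x, w) - m)) ∂μ ≤
      Real.exp (((c / 2) ^ 2 : ℝ≥0) * t ^ 2 / 2) *
        Real.exp (t * ((∫ x, F (x, w) ∂μ) - m)) := fun w => by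
    calc ∫ x, Real.exp (t * (F (x, w) - m)) ∂μ
        = ∫ x, Real.exp (t * (F (x, w) - ∫ x, F (x, w) ∂μ)) *
            Real.exp (t * ((∫ x, F (x, w) ∂μ) - m)) ∂μ := by
          congr with x
          rw [← Real.exp_add]
          ring_nf
      _ ≤ _ := by
          rw [integral_mul_const]
          gcongr
          exact (hasSubgaussianMGF_sub_integral_of_sub_le (by fun_prop)
            fun x x' => hc x x' w).mgf_le t
  calc mgf (fun p => F p - m) (μ.prod ν) t
      = ∫ w, ∫ x, Real.exp (t * (F (x, w) - m)) ∂μ ∂ν := by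
        rw [mgf, integral_prod_symm _ (hint t)]
    _ ≤ ∫ w, Real.exp (((c / 2) ^ 2 : ℝ≥0) * t ^ 2 / 2) *
        Real.exp (t * ((∫ x, F (x, w) ∂μ) - m)) ∂ν :=
        integral_mono (hint t).integral_prod_right ((h.integrable_exp_mul t).const_mul _) hsection
    _ ≤ Real.exp (((c / 2) ^ 2 : ℝ≥0) * t ^ 2 / 2) * Real.exp (C * t ^ 2 / 2) := by
        rw [integral_const_mul]
        gcongr
        exact h.mgf_le t
    _ = Real.exp (((c / 2) ^ 2 + C : ℝ≥0) * t ^ 2 / 2) := by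
        rw [← Real.exp_add]
        push_cast
        ring_nf

theorem hasSubgaussianMGF_pi_of_bounded_differences {n : ℕ} {Z : Fin n → Type*}
    [∀ i, MeasurableSpace (Z i)] (ν : ∀ i, Measure (Z i)) [∀ i, IsProbabilityMeasure (ν i)]
    {f : (∀ i, Z i) → ℝ} (hf : Measurable f) {b : ℝ} (hb : ∀ z, |f z| ≤ b) (c : Fin n → ℝ≥0)
    (hc : ∀ i z x, f (Function.update z i x) - f z ≤ c i) :
    HasSubgaussianMGF (fun z => f z - ∫ z, f z ∂(Measure.pi ν)) (∑ i, (c i / 2) ^ 2)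
      (Measure.pi ν) := by
  induction n with
  | zero =>
    have : (fun z => f z - ∫ z, f z ∂(Measure.pi ν)) = fun _ => 0 := by
      funext z
      rw [Measure.pi_of_empty ν z, integral_dirac' _ _ hf.stronglyMeasurable, sub_self]
    simp [this]
  | succ n ih =>
    let ν' : ∀ j : Fin n, Measure (Z j.succ) := fun j => ν j.succ
    have hsplit : MeasurePreserving (fun z : ∀ i, Z i => (z 0, Fin.tail z)) (Measure.pi ν)
        ((ν 0).prod (Measure.pi ν')) := measurePreserving_piFinSuccAbove ν 0
    let F : Z 0 × (∀ j : Fin n, Z j.succ) → ℝ := fun p => f (Fin.cons p.1 p.2)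
    have hF : Measurable F := hf.comp (measurable_pi_iff.2
      (Fin.cases measurable_fst fun j => (measurable_pi_apply j).comp measurable_snd))
    have hFf : ∀ z, F (z 0, Fin.tail z) = f z := fun z => congrArg f (Fin.cons_self_tail z)
    have hint : ∀ w, Integrable (fun x => F (x, w)) (ν 0) := fun w =>
      Integrable.of_bound (hF.comp measurable_prodMk_right).aestronglyMeasurable b
        (ae_of_all _ fun x => hb _)
    have hmean : ∫ z, f z ∂(Measure.pi ν) = ∫ p, F p ∂((ν 0).prod (Measure.pi ν')) := by
      simp only [← integral_comp_of_measurePreserving hsplit hF.aestronglyMeasurable, hFf]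
    have hpartial : HasSubgaussianMGF
        (fun w => (∫ x, F (x, w) ∂(ν 0)) - ∫ w, ∫ x, F (x, w) ∂(ν 0) ∂(Measure.pi ν'))
        (∑ j : Fin n, (c j.succ / 2) ^ 2) (Measure.pi ν') := by
      refine ih ν' hF.stronglyMeasurable.integral_prod_left'.measurable
        (fun w => abs_integral_le_of_abs_le (ν 0) fun x => hb _) _ fun i w x => ?_
      rw [← integral_sub (hint _) (hint _)]
      refine (integral_mono ((hint _).sub (hint _)) (integrable_const (c i.succ : ℝ))
        fun y => ?_).trans_eq (by simp)
      simpa [F, Fin.cons_update] using hc i.succ (Fin.cons y w) x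
    have htotal := hasSubgaussianMGF_prod (ν 0) (Measure.pi ν') hF (fun _ => hb _) (c := c 0)
      (fun x x' w => by simpa [F] using hc 0 (Fin.cons x' w) x) hpartial
    rw [← hmean, ← hsplit.map_eq] at htotal
    rw [Fin.sum_univ_succ]
    exact (HasSubgaussianMGF.of_map hsplit.aemeasurable htotal).congr
      (ae_of_all _ fun z => congrArg (· - _) (hFf z))

theorem measureReal_gt_le_of_bounded_differences {n : ℕ} {Z : Fin n → Type*}
    [∀ i, MeasurableSpace (Z i)] (ν : ∀ i, Measure (Z i)) [∀ i, IsProbabilityMeasure (ν i)]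
    {f : (∀ i, Z i) → ℝ} (hf : Measurable f) {b : ℝ} (hb : ∀ z, |f z| ≤ b) (c : Fin n → ℝ≥0)
    (hc : ∀ i z x, f (Function.update z i x) - f z ≤ c i) {m : ℝ}
    (hm : ∫ z, f z ∂(Measure.pi ν) ≤ m) {δ : ℝ} (hδ : 0 < δ) :
    (Measure.pi ν).real {z | m + √((∑ i, (c i : ℝ) ^ 2) / 2 * Real.log (1 / δ)) < f z} ≤ δ := by
  refine (measureReal_mono (Set.ofPred_subset_ofPred.2 fun z hz => ?_)).trans
    (measureReal_sqrt_lt_le_of_hasSubgaussianMGF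
      (hasSubgaussianMGF_pi_of_bounded_differences ν hf hb c hc) hδ)
  have hvar : 2 * ((∑ i, (c i / 2) ^ 2 : ℝ≥0) : ℝ) = (∑ i, (c i : ℝ) ^ 2) / 2 := by
    push_cast
    simp_rw [div_pow, ← Finset.sum_div]
    ring
  rw [hvar]
  linarith

end Concentration

section Suprema

variable {ι : Type*} {F G : ι → ℝ}

lemma bddAbove_range_of_abs_le {b : ℝ} (hF : ∀ i, |F i| ≤ b) : BddAbove (Set.range F) :=
  ⟨b, Set.forall_mem_range.2 fun i => le_of_abs_le (hF i)⟩

lemma abs_iSup_le {b : ℝ≥0} (hF : ∀ i, |F i| ≤ b) : |⨆ i, F i| ≤ b := by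
  rcases isEmpty_or_nonempty ι with _ | ⟨⟨i⟩⟩
  · simp
  · exact abs_le.2 ⟨(neg_le_of_abs_le (hF i)).trans (le_ciSup (bddAbove_range_of_abs_le hF) i),
      Real.iSup_le (fun i => le_of_abs_le (hF i)) b.2⟩

lemma iSup_sub_iSup_le (hG : BddAbove (Set.range G)) {c : ℝ≥0} (h : ∀ i, F i - G i ≤ c) :
    (⨆ i, F i) - ⨆ i, G i ≤ c := by
  rcases isEmpty_or_nonempty ι with _ | _
  · simp
  · exact sub_le_iff_le_add.2 (ciSup_le fun i =>
      (sub_le_iff_le_add.1 (h i)).trans (add_le_add_right (le_ciSup hG i) _))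

lemma measurable_iSup_of_continuous {W : Type*} [TopologicalSpace W] [MeasurableSpace W]
    [OpensMeasurableSpace W] {F : ι → W → ℝ} (hF : ∀ i, Continuous (F i))
    (hb : ∀ w, BddAbove (Set.range fun i => F i w)) : Measurable fun w => ⨆ i, F i w :=
  (lowerSemicontinuous_ciSup hb fun i => (hF i).lowerSemicontinuous).measurable

end Suprema

lemma sum_comp_update_sub {ι Z : Type*} [DecidableEq ι] (f : Z → ℝ) {I : Finset ι} {i : ι}
    (hi : i ∈ I) (z : ι → Z) (x : Z) :
    ∑ j ∈ I, f (Function.update z i x j) - ∑ j ∈ I, f (z j) = f x - f (z i) := by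
  rw [← Finset.sum_sub_distrib, Finset.sum_eq_single_of_mem i hi fun j _ hj => by
    rw [Function.update_of_ne hj, sub_self], Function.update_self]

section SignedAverages

variable {ι Z : Type*} {n : ℕ}

/-- The average of `g (z i)` with the signs `σ`, where `true` stands for `+1`. -/
def signedAverage (g : Z → ℝ) (σ : Fin n → Bool) (z : Fin n → Z) : ℝ :=
  (1 / (n : ℝ)) * ∑ i, (if σ i then (1 : ℝ) else -1) * g (z i)

/-- The supremum of the signed averages over the family `g`, whose mean over uniform signs is the
empirical Rademacher complexity of `g`. -/
def signedSup (g : ι → Z → ℝ) (σ : Fin n → Bool) (z : Fin n → Z) : ℝ :=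
  ⨆ h, signedAverage (g h) σ z

lemma signedAverage_true (g : Z → ℝ) (z : Fin n → Z) :
    signedAverage g (fun _ => true) z = (1 / (n : ℝ)) * ∑ i, g (z i) := by
  simp [signedAverage]

lemma continuous_signedAverage [TopologicalSpace Z] {g : Z → ℝ} (hg : Continuous g)
    (σ : Fin n → Bool) : Continuous (signedAverage g σ) := by
  unfold signedAverage
  fun_prop

lemma abs_signedAverage_le {g : Z → ℝ} {B : ℝ≥0} (hg : ∀ p, |g p| ≤ B) (σ : Fin n → Bool)
    (z : Fin n → Z) : |signedAverage g σ z| ≤ B := by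
  rcases n.eq_zero_or_pos with rfl | hn
  · simp [signedAverage]
  calc |signedAverage g σ z|
      ≤ 1 / (n : ℝ) * ∑ i, |(if σ i then (1 : ℝ) else -1) * g (z i)| := by
        rw [signedAverage, abs_mul, abs_of_nonneg (by positivity : (0 : ℝ) ≤ 1 / n)]
        gcongr
        exact Finset.abs_sum_le_sum_abs _ _
    _ ≤ 1 / (n : ℝ) * ∑ _i : Fin n, (B : ℝ) := by
        gcongr with i
        split_ifs <;> simpa using hg (z i)
    _ = B := by
        simp only [Finset.sum_const, Finset.card_univ, Fintype.card_fin, nsmul_eq_mul]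
        field_simp

variable {g : ι → Z → ℝ} {B : ℝ≥0}

lemma abs_signedSup_le (hg : ∀ h p, |g h p| ≤ B) (σ : Fin n → Bool) (z : Fin n → Z) :
    |signedSup g σ z| ≤ B :=
  abs_iSup_le fun h => abs_signedAverage_le (hg h) σ z

lemma bddAbove_range_signedAverage (hg : ∀ h p, |g h p| ≤ B) (σ : Fin n → Bool) (z : Fin n → Z) :
    BddAbove (Set.range fun h => signedAverage (g h) σ z) :=
  bddAbove_range_of_abs_le fun h => abs_signedAverage_le (hg h) σ z

lemma signedAverage_le_signedSup (hg : ∀ h p, |g h p| ≤ B) (σ : Fin n → Bool) (z : Fin n → Z)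
    (h : ι) : signedAverage (g h) σ z ≤ signedSup g σ z :=
  le_ciSup (bddAbove_range_signedAverage hg σ z) h

lemma signedAverage_succ_eq (g : Z → ℝ) (hn : 0 < n) (σ : Fin (n + 1) → Bool)
    (z : Fin (n + 1) → Z) :
    signedAverage g σ z = (1 / (n + 1 : ℝ)) *
      ∑ j : Fin (n + 1), signedAverage g (j.removeNth σ) (j.removeNth z) := by
  let x : Fin (n + 1) → ℝ := fun i => (if σ i then (1 : ℝ) else -1) * g (z i)
  have hleave : ∀ j : Fin (n + 1), ∑ i, x (j.succAbove i) = (∑ i, x i) - x j := fun j => by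
    rw [Fin.sum_univ_succAbove x j, add_sub_cancel_left]
  have hsum : ∑ j : Fin (n + 1), ∑ i, x (j.succAbove i) = n * ∑ i, x i := by
    simp only [hleave, Finset.sum_sub_distrib, Finset.sum_const, Finset.card_univ,
      Fintype.card_fin, nsmul_eq_mul]
    push_cast
    ring
  simp only [signedAverage, Fin.removeNth_apply, ← Finset.mul_sum]
  change _ * ∑ i, x i = _ * (_ * ∑ j : Fin (n + 1), ∑ i, x (j.succAbove i))
  rw [hsum]
  push_cast
  field_simp

lemma signedSup_succ_le (hg : ∀ h p, |g h p| ≤ B) (hn : 0 < n) (σ : Fin (n + 1) → Bool)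
    (z : Fin (n + 1) → Z) :
    signedSup g σ z ≤ (1 / (n + 1 : ℝ)) *
      ∑ j : Fin (n + 1), signedSup g (j.removeNth σ) (j.removeNth z) := by
  rcases isEmpty_or_nonempty ι with _ | _
  · simp [signedSup]
  refine ciSup_le fun h => (signedAverage_succ_eq (g h) hn σ z).trans_le ?_
  gcongr with j
  exact signedAverage_le_signedSup hg _ _ h

variable [TopologicalSpace Z] [SecondCountableTopology Z] [MeasurableSpace Z] [BorelSpace Z]

lemma measurable_signedSup (hc : ∀ h, Continuous (g h)) (hg : ∀ h p, |g h p| ≤ B)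
    (σ : Fin n → Bool) : Measurable (signedSup g σ) :=
  measurable_iSup_of_continuous (fun h => continuous_signedAverage (hc h) σ)
    (bddAbove_range_signedAverage hg σ)

lemma integrable_signedSup (μ : Measure Z) [IsProbabilityMeasure μ] (hc : ∀ h, Continuous (g h))
    (hg : ∀ h p, |g h p| ≤ B) (σ : Fin n → Bool) :
    Integrable (signedSup g σ) (Measure.pi fun _ : Fin n => μ) :=
  Integrable.of_bound (measurable_signedSup hc hg σ).aestronglyMeasurable B
    (ae_of_all _ (abs_signedSup_le hg σ))

end SignedAverages

section RademacherComplexity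

variable {ι Z : Type*} [MeasurableSpace Z]

/-- The Rademacher complexity of a family of functions on `Z`, for samples of size `n`. -/
def radComplexity (μ : Measure Z) (g : ι → Z → ℝ) (n : ℕ) : ℝ :=
  ∫ z, (1 / 2 ^ n : ℝ) * ∑ σ : Fin n → Bool, signedSup g σ z ∂(Measure.pi fun _ : Fin n => μ)

lemma measurePreserving_removeNth (μ : Measure Z) [IsProbabilityMeasure μ] {n : ℕ}
    (j : Fin (n + 1)) :
    MeasurePreserving (fun z : Fin (n + 1) → Z => j.removeNth z)
      (Measure.pi fun _ => μ) (Measure.pi fun _ => μ) :=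
  (measurePreserving_snd (μ := μ) (ν := Measure.pi fun _ : Fin n => μ)).comp
    (measurePreserving_piFinSuccAbove (fun _ : Fin (n + 1) => μ) j)

lemma sum_comp_removeNth {n : ℕ} (A : (Fin n → Bool) → ℝ) (j : Fin (n + 1)) :
    ∑ σ : Fin (n + 1) → Bool, A (j.removeNth σ) = 2 * ∑ τ, A τ := by
  rw [← (Fin.insertNthEquiv (fun _ => Bool) j).sum_comp, Fintype.sum_prod_type]
  simp [Fin.insertNthEquiv, two_mul]

variable [TopologicalSpace Z] [SecondCountableTopology Z] [BorelSpace Z]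
  (μ : Measure Z) [IsProbabilityMeasure μ] {g : ι → Z → ℝ} {B : ℝ≥0}

lemma radComplexity_eq (hc : ∀ h, Continuous (g h)) (hg : ∀ h p, |g h p| ≤ B) (n : ℕ) :
    radComplexity μ g n = (1 / 2 ^ n : ℝ) *
      ∑ σ : Fin n → Bool, ∫ z, signedSup g σ z ∂(Measure.pi fun _ : Fin n => μ) := by
  rw [radComplexity, integral_const_mul,
    integral_finsetSum _ fun σ _ => integrable_signedSup μ hc hg σ]

lemma integral_signedSup_succ_le (hc : ∀ h, Continuous (g h)) (hg : ∀ h p, |g h p| ≤ B) {n : ℕ}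
    (hn : 0 < n) (σ : Fin (n + 1) → Bool) :
    ∫ z, signedSup g σ z ∂(Measure.pi fun _ => μ) ≤ (1 / (n + 1 : ℝ)) *
      ∑ j : Fin (n + 1), ∫ z, signedSup g (j.removeNth σ) z ∂(Measure.pi fun _ => μ) := by
  have hremove : ∀ j : Fin (n + 1), Integrable
      (fun z : Fin (n + 1) → Z => signedSup g (j.removeNth σ) (j.removeNth z))
      (Measure.pi fun _ => μ) := fun j =>
    (measurePreserving_removeNth μ j).integrable_comp_of_integrable (integrable_signedSup μ hc hg _)
  calc ∫ z, signedSup g σ z ∂(Measure.pi fun _ => μ)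
      ≤ ∫ z, (1 / (n + 1 : ℝ)) * ∑ j : Fin (n + 1),
          signedSup g (j.removeNth σ) (j.removeNth z) ∂(Measure.pi fun _ => μ) :=
        integral_mono (integrable_signedSup μ hc hg σ)
          ((integrable_finsetSum _ fun j _ => hremove j).const_mul _) (signedSup_succ_le hg hn σ)
    _ = _ := by
        rw [integral_const_mul, integral_finsetSum _ fun j _ => hremove j]
        congr 2 with j
        exact integral_comp_of_measurePreserving (measurePreserving_removeNth μ j)
          (measurable_signedSup hc hg _).aestronglyMeasurable

lemma radComplexity_succ_le (hc : ∀ h, Continuous (g h)) (hg : ∀ h p, |g h p| ≤ B) {n : ℕ}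
    (hn : 0 < n) : radComplexity μ g (n + 1) ≤ radComplexity μ g n := by
  rw [radComplexity_eq μ hc hg, radComplexity_eq μ hc hg]
  set A : (Fin n → Bool) → ℝ := fun τ => ∫ z, signedSup g τ z ∂(Measure.pi fun _ => μ)
  calc _ ≤ (1 / 2 ^ (n + 1) : ℝ) * ∑ σ : Fin (n + 1) → Bool,
        (1 / (n + 1 : ℝ)) * ∑ j : Fin (n + 1), A (j.removeNth σ) := by
        gcongr with σ
        exact integral_signedSup_succ_le μ hc hg hn σ
    _ = (1 / 2 ^ n : ℝ) * ∑ τ, A τ := by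
        rw [← Finset.mul_sum, Finset.sum_comm]
        simp only [sum_comp_removeNth, Finset.sum_const, Finset.card_univ, Fintype.card_fin,
          nsmul_eq_mul]
        push_cast
        field_simp
        ring

lemma radComplexity_antitoneOn (hc : ∀ h, Continuous (g h)) (hg : ∀ h p, |g h p| ≤ B) :
    AntitoneOn (radComplexity μ g) (Set.Ioi 0) := by
  intro n hn m _ hnm
  induction m, hnm using Nat.le_induction with
  | base => exact le_rfl
  | succ m hm ih =>
    have hm0 : 0 < m := lt_of_lt_of_le hn hm
    exact (radComplexity_succ_le μ hc hg hm0).trans (ih hm0)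

end RademacherComplexity

section Symmetrization

variable {ι Z : Type*} {B : ℝ≥0} {n : ℕ}

/-- The differences `q ↦ g h q.2 - g h q.1` on pairs of points: a sample together with its ghost
sample is a sample of such pairs. -/
def ghostDiff (g : ι → Z → ℝ) (h : ι) (q : Z × Z) : ℝ :=
  g h q.2 - g h q.1

variable {g : ι → Z → ℝ}

lemma abs_ghostDiff_le (hg : ∀ h p, |g h p| ≤ B) (h : ι) (q : Z × Z) :
    |ghostDiff g h q| ≤ (2 * B : ℝ≥0) := by
  have hsub : |ghostDiff g h q| ≤ |g h q.2| + |g h q.1| := abs_sub _ _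
  push_cast
  linarith [hg h q.1, hg h q.2]

lemma signedSup_ghostDiff_le (hg : ∀ h p, |g h p| ≤ B) (σ : Fin n → Bool) (q : Fin n → Z × Z) :
    signedSup (ghostDiff g) σ q ≤
      signedSup g σ (fun i => (q i).2) + signedSup g (fun i => !σ i) (fun i => (q i).1) := by
  rcases isEmpty_or_nonempty ι with _ | _
  · simp [signedSup]
  refine ciSup_le fun h => ?_
  have hsplit : signedAverage (ghostDiff g h) σ q =
      signedAverage (g h) σ (fun i => (q i).2) +
        signedAverage (g h) (fun i => !σ i) (fun i => (q i).1) := by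
    have hnot : ∀ b : Bool, (if !b then (1 : ℝ) else -1) = -(if b then 1 else -1) := by
      rintro (_ | _) <;> simp
    simp only [signedAverage, ghostDiff, hnot, ← mul_add, ← Finset.sum_add_distrib]
    congr with i
    ring
  rw [hsplit]
  exact add_le_add (signedAverage_le_signedSup hg _ _ h) (signedAverage_le_signedSup hg _ _ h)

lemma signedSup_ghostDiff_swap (σ : Fin n → Bool) (q : Fin n → Z × Z) :
    signedSup (ghostDiff g) (fun _ => true) (fun i => if σ i then q i else (q i).swap) =
      signedSup (ghostDiff g) σ q := by
  simp only [signedSup, signedAverage, ghostDiff]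
  congr! 4 with h i
  cases σ i <;> simp

lemma continuous_ghostDiff [TopologicalSpace Z] (hc : ∀ h, Continuous (g h)) (h : ι) :
    Continuous (ghostDiff g h) :=
  ((hc h).comp continuous_snd).sub ((hc h).comp continuous_fst)

variable [MeasurableSpace Z]

/-- The one-sided uniform deviation of the sample means from the means over a family `g`. -/
def uniformDev (μ : Measure Z) (g : ι → Z → ℝ) (z : Fin n → Z) : ℝ :=
  ⨆ h, ((∫ p, g h p ∂μ) - (1 / (n : ℝ)) * ∑ i, g h (z i))

variable (μ : Measure Z) [IsProbabilityMeasure μ]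

lemma abs_deviation_le {g : Z → ℝ} (hg : ∀ p, |g p| ≤ B) (z : Fin n → Z) :
    |(∫ p, g p ∂μ) - (1 / (n : ℝ)) * ∑ i, g (z i)| ≤ (2 * B : ℝ≥0) := by
  rw [← signedAverage_true]
  push_cast
  linarith [abs_sub (∫ p, g p ∂μ) (signedAverage g (fun _ => true) z),
    abs_integral_le_of_abs_le μ hg, abs_signedAverage_le hg (fun _ => true) z]

lemma abs_uniformDev_le (hg : ∀ h p, |g h p| ≤ B) (z : Fin n → Z) :
    |uniformDev μ g z| ≤ (2 * B : ℝ≥0) :=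
  abs_iSup_le fun h => abs_deviation_le μ (hg h) z

lemma bddAbove_range_deviation (hg : ∀ h p, |g h p| ≤ B) (z : Fin n → Z) :
    BddAbove (Set.range fun h => (∫ p, g h p ∂μ) - (1 / (n : ℝ)) * ∑ i, g h (z i)) :=
  bddAbove_range_of_abs_le fun h => abs_deviation_le μ (hg h) z

lemma integral_sub_average_le_uniformDev (hg : ∀ h p, |g h p| ≤ B) (z : Fin n → Z) (h : ι) :
    (∫ p, g h p ∂μ) - (1 / (n : ℝ)) * ∑ i, g h (z i) ≤ uniformDev μ g z :=
  le_ciSup (bddAbove_range_deviation μ hg z) h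

lemma uniformDev_update_sub_le (hg : ∀ h p, 0 ≤ g h p ∧ g h p ≤ B) (z : Fin n → Z) (i : Fin n)
    (x : Z) : uniformDev μ g (Function.update z i x) - uniformDev μ g z ≤ (B / n : ℝ≥0) := by
  have habs : ∀ h p, |g h p| ≤ B := fun h p => (abs_of_nonneg (hg h p).1).trans_le (hg h p).2
  refine iSup_sub_iSup_le (bddAbove_range_deviation μ habs z) fun h => ?_
  have hdiff := sum_comp_update_sub (g h) (Finset.mem_univ i) z x
  calc _ = (1 / (n : ℝ)) * (g h (z i) - g h x) := by linear_combination (-1 / (n : ℝ)) * hdiff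
    _ ≤ (1 / (n : ℝ)) * B := by
        gcongr
        linarith [(hg h (z i)).2, (hg h x).1]
    _ = (B / n : ℝ≥0) := by
        push_cast
        ring

lemma measurePreserving_swap_of_signs (σ : Fin n → Bool) :
    MeasurePreserving (fun (q : Fin n → Z × Z) i => if σ i then q i else (q i).swap)
      (Measure.pi fun _ => μ.prod μ) (Measure.pi fun _ => μ.prod μ) :=
  measurePreserving_pi (f := fun i (r : Z × Z) => if σ i then r else r.swap) _ _ fun i => by
    cases σ i
    · simpa using Measure.measurePreserving_swap
    · simpa using! MeasurePreserving.id (μ.prod μ)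

lemma integral_sample_eval {f : Z → ℝ} (hf : AEStronglyMeasurable f μ) (i : Fin n) :
    ∫ z, f (z i) ∂(Measure.pi fun _ => μ) = ∫ p, f p ∂μ :=
  integral_comp_of_measurePreserving (measurePreserving_eval (fun _ : Fin n => μ) i) hf

lemma integral_ghost_average {f : Z → ℝ} (hm : Measurable f) (hf : ∀ p, |f p| ≤ B) (hn : 0 < n)
    (z : Fin n → Z) :
    ∫ z', (1 / (n : ℝ)) * ∑ i, (f (z' i) - f (z i)) ∂(Measure.pi fun _ => μ) =
      (∫ p, f p ∂μ) - (1 / (n : ℝ)) * ∑ i, f (z i) := by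
  have hint : ∀ i : Fin n, Integrable (fun z' : Fin n → Z => f (z' i)) (Measure.pi fun _ => μ) :=
    fun i => Integrable.of_bound (hm.comp (measurable_pi_apply i)).aestronglyMeasurable B
      (ae_of_all _ fun z' => hf _)
  have hdiff : ∀ i ∈ Finset.univ, Integrable (fun z' : Fin n → Z => f (z' i) - f (z i))
      (Measure.pi fun _ => μ) := fun i _ => (hint i).sub (integrable_const _)
  have hsum : ∫ z', ∑ i, (f (z' i) - f (z i)) ∂(Measure.pi fun _ : Fin n => μ) =
      ∑ i : Fin n, ((∫ p, f p ∂μ) - f (z i)) := by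
    rw [integral_finsetSum _ hdiff]
    congr with i
    rw [integral_sub (hint i) (integrable_const _),
      integral_sample_eval μ hm.aestronglyMeasurable, integral_const, probReal_univ, one_smul]
  rw [integral_const_mul, hsum, Finset.sum_sub_distrib, Finset.sum_const, Finset.card_univ,
    Fintype.card_fin, nsmul_eq_mul]
  field_simp

variable [TopologicalSpace Z] [SecondCountableTopology Z] [BorelSpace Z]

lemma measurable_uniformDev (hc : ∀ h, Continuous (g h)) (hg : ∀ h p, |g h p| ≤ B) :
    Measurable (uniformDev (n := n) μ g) :=
  measurable_iSup_of_continuous (fun h => by have := hc h; fun_prop)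
    (bddAbove_range_deviation μ hg)

-- The uniform deviation is a supremum of means over the ghost sample, hence at most the mean of
-- the supremum.
lemma uniformDev_le_integral_ghost (hc : ∀ h, Continuous (g h)) (hg : ∀ h p, |g h p| ≤ B)
    (hn : 0 < n) (z : Fin n → Z) :
    uniformDev μ g z ≤ ∫ z', signedSup (ghostDiff g) (fun _ => true) (fun i => (z i, z' i))
      ∂(Measure.pi fun _ => μ) := by
  rcases isEmpty_or_nonempty ι with _ | _
  · simp [uniformDev, signedSup]
  refine ciSup_le fun h => ?_
  rw [← integral_ghost_average μ (hc h).measurable (hg h) hn]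
  have hpair : Measurable fun z' : Fin n → Z => fun i => (z i, z' i) := by fun_prop
  have hcg := continuous_ghostDiff hc
  have hbg := abs_ghostDiff_le hg
  have haverage : ∀ z' : Fin n → Z, (1 / (n : ℝ)) * ∑ i, (g h (z' i) - g h (z i)) =
      signedAverage (ghostDiff g h) (fun _ => true) fun i => (z i, z' i) := fun z' => by
    rw [signedAverage_true]
    rfl
  simp only [haverage]
  refine integral_mono (Integrable.of_bound ?_ _
    (ae_of_all _ fun z' => abs_signedAverage_le (hbg h) _ _)) (Integrable.of_bound
      ((measurable_signedSup hcg hbg _).comp hpair).aestronglyMeasurable _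
      (ae_of_all _ fun z' => abs_signedSup_le hbg _ _))
    fun z' => signedAverage_le_signedSup hbg _ _ h
  exact (((continuous_signedAverage (hcg h) _).measurable).comp hpair).aestronglyMeasurable

-- Exchanging `z i` with its ghost point flips the sign of the `i`-th difference, so the mean is
-- the same for all signs.
lemma integral_signedSup_ghostDiff_eq (hc : ∀ h, Continuous (g h)) (hg : ∀ h p, |g h p| ≤ B)
    (σ : Fin n → Bool) :
    ∫ q, signedSup (ghostDiff g) σ q ∂(Measure.pi fun _ => μ.prod μ) =
      ∫ q, signedSup (ghostDiff g) (fun _ : Fin n => true) q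
        ∂(Measure.pi fun _ => μ.prod μ) := by
  rw [← integral_comp_of_measurePreserving (measurePreserving_swap_of_signs μ σ)
    (measurable_signedSup (continuous_ghostDiff hc) (abs_ghostDiff_le hg)
      (fun _ => true)).aestronglyMeasurable]
  simp only [signedSup_ghostDiff_swap]

lemma integral_signedSup_ghostDiff_le (hc : ∀ h, Continuous (g h)) (hg : ∀ h p, |g h p| ≤ B)
    (σ : Fin n → Bool) :
    ∫ q, signedSup (ghostDiff g) σ q ∂(Measure.pi fun _ => μ.prod μ) ≤
      ∫ z, signedSup g σ z ∂(Measure.pi fun _ => μ) +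
        ∫ z, signedSup g (fun i => !σ i) z ∂(Measure.pi fun _ => μ) := by
  have hfst : MeasurePreserving (fun (q : Fin n → Z × Z) i => (q i).1)
      (Measure.pi fun _ => μ.prod μ) (Measure.pi fun _ => μ) :=
    measurePreserving_pi _ _ fun _ => measurePreserving_fst
  have hsnd : MeasurePreserving (fun (q : Fin n → Z × Z) i => (q i).2)
      (Measure.pi fun _ => μ.prod μ) (Measure.pi fun _ => μ) :=
    measurePreserving_pi _ _ fun _ => measurePreserving_snd
  have hint₁ : Integrable (fun q : Fin n → Z × Z => signedSup g (fun i => !σ i) fun i => (q i).1)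
      (Measure.pi fun _ => μ.prod μ) :=
    hfst.integrable_comp_of_integrable (integrable_signedSup μ hc hg _)
  have hint₂ : Integrable (fun q : Fin n → Z × Z => signedSup g σ fun i => (q i).2)
      (Measure.pi fun _ => μ.prod μ) :=
    hsnd.integrable_comp_of_integrable (integrable_signedSup μ hc hg σ)
  rw [← integral_comp_of_measurePreserving hsnd
      (measurable_signedSup hc hg σ).aestronglyMeasurable,
    ← integral_comp_of_measurePreserving hfst
      (measurable_signedSup hc hg fun i => !σ i).aestronglyMeasurable,
    ← integral_add hint₂ hint₁]
  exact integral_mono (integrable_signedSup _ (continuous_ghostDiff hc) (abs_ghostDiff_le hg) σ)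
    (hint₂.add hint₁) (signedSup_ghostDiff_le hg σ)

lemma integral_uniformDev_le_ghost (hc : ∀ h, Continuous (g h)) (hg : ∀ h p, |g h p| ≤ B)
    (hn : 0 < n) :
    ∫ z, uniformDev μ g z ∂(Measure.pi fun _ : Fin n => μ) ≤
      ∫ q, signedSup (ghostDiff g) (fun _ => true) q
        ∂(Measure.pi fun _ : Fin n => μ.prod μ) := by
  have hpair := measurePreserving_arrowProdEquivProdArrow Z Z (Fin n) (fun _ => μ) (fun _ => μ)
  have hint : Integrable (fun p => signedSup (ghostDiff g) (fun _ : Fin n => true)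
      ((MeasurableEquiv.arrowProdEquivProdArrow Z Z (Fin n)).symm p))
      ((Measure.pi fun _ => μ).prod (Measure.pi fun _ => μ)) :=
    hpair.symm.integrable_comp_of_integrable (integrable_signedSup (μ.prod μ)
      (continuous_ghostDiff hc) (abs_ghostDiff_le hg) _)
  rw [← integral_comp_of_measurePreserving hpair.symm (measurable_signedSup
    (continuous_ghostDiff hc) (abs_ghostDiff_le hg) fun _ => true).aestronglyMeasurable,
    integral_prod _ hint]
  exact integral_mono (Integrable.of_bound (measurable_uniformDev μ hc hg).aestronglyMeasurable _
    (ae_of_all _ (abs_uniformDev_le μ hg))) hint.integral_prod_left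
    (uniformDev_le_integral_ghost μ hc hg hn)

theorem integral_uniformDev_le (hc : ∀ h, Continuous (g h)) (hg : ∀ h p, |g h p| ≤ B)
    (hn : 0 < n) :
    ∫ z, uniformDev μ g z ∂(Measure.pi fun _ : Fin n => μ) ≤ 2 * radComplexity μ g n := by
  have hflip : ∑ σ : Fin n → Bool, ∫ z, signedSup g (fun i => !σ i) z ∂(Measure.pi fun _ => μ) =
      ∑ σ : Fin n → Bool, ∫ z, signedSup g σ z ∂(Measure.pi fun _ => μ) :=
    (Equiv.piCongrRight fun _ => Equiv.boolNot).sum_comp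
      fun σ => ∫ z, signedSup g σ z ∂(Measure.pi fun _ => μ)
  calc ∫ z, uniformDev μ g z ∂(Measure.pi fun _ : Fin n => μ)
      ≤ ∫ q, signedSup (ghostDiff g) (fun _ => true) q
          ∂(Measure.pi fun _ : Fin n => μ.prod μ) := integral_uniformDev_le_ghost μ hc hg hn
    _ = (1 / 2 ^ n : ℝ) * ∑ σ : Fin n → Bool,
          ∫ q, signedSup (ghostDiff g) σ q ∂(Measure.pi fun _ => μ.prod μ) := by
        simp [integral_signedSup_ghostDiff_eq μ hc hg]
    _ ≤ (1 / 2 ^ n : ℝ) * ∑ σ : Fin n → Bool,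
          (∫ z, signedSup g σ z ∂(Measure.pi fun _ => μ) +
            ∫ z, signedSup g (fun i => !σ i) z ∂(Measure.pi fun _ => μ)) := by
        gcongr with σ
        exact integral_signedSup_ghostDiff_le μ hc hg σ
    _ = 2 * radComplexity μ g n := by
        rw [Finset.sum_add_distrib, hflip, radComplexity_eq μ hc hg]
        ring

lemma hasSubgaussianMGF_uniformDev (hc : ∀ h, Continuous (g h))
    (hg : ∀ h p, 0 ≤ g h p ∧ g h p ≤ B) :
    HasSubgaussianMGF
      (fun z => uniformDev μ g z - ∫ z, uniformDev μ g z ∂(Measure.pi fun _ : Fin n => μ))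
      (B ^ 2 / (4 * n)) (Measure.pi fun _ : Fin n => μ) := by
  have habs : ∀ h p, |g h p| ≤ B := fun h p => (abs_of_nonneg (hg h p).1).trans_le (hg h p).2
  have hvar : ∑ _i : Fin n, (B / n / 2) ^ 2 = B ^ 2 / (4 * n) := by
    simp only [Finset.sum_const, Finset.card_univ, Fintype.card_fin, nsmul_eq_mul]
    field_simp
    ring
  rw [← hvar]
  exact hasSubgaussianMGF_pi_of_bounded_differences _ (measurable_uniformDev μ hc habs)
    (abs_uniformDev_le μ habs) _ fun i z x => uniformDev_update_sub_le μ hg z i x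

end Symmetrization

lemma integral_abs_sub_integral_le_sqrt_variance {Ω : Type*} [MeasurableSpace Ω] {μ : Measure Ω}
    [IsProbabilityMeasure μ] {X : Ω → ℝ} (hX : MemLp X 2 μ) :
    ∫ ω, |X ω - ∫ ω, X ω ∂μ| ∂μ ≤ √(variance X μ) := by
  have hW : MemLp (fun ω => |X ω - ∫ ω, X ω ∂μ|) 2 μ := (hX.sub (memLp_const _)).abs
  have hsq : μ[(fun ω => |X ω - ∫ ω, X ω ∂μ|) ^ 2] = variance X μ := by
    simp [variance_eq_integral hX.aemeasurable]
  refine Real.le_sqrt_of_sq_le (sub_nonneg.1 ?_)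
  rw [← hsq, ← variance_eq_sub hW]
  exact variance_nonneg _ _

section Averages

variable {κ Z : Type*} [Fintype κ] [MeasurableSpace Z] (ν : κ → Measure Z)
  [∀ i, IsProbabilityMeasure (ν i)] {I : Finset κ} {f : Z → ℝ}

lemma memLp_coordinate (hf : Measurable f) (hf01 : ∀ z, f z ∈ Set.Icc (0 : ℝ) 1) (i : κ) :
    MemLp (fun z : κ → Z => f (z i)) 2 (Measure.pi ν) :=
  memLp_of_bounded (ae_of_all _ fun z : κ → Z => hf01 (z i))
    (hf.comp (measurable_pi_apply i)).aestronglyMeasurable 2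

lemma memLp_average (hf : Measurable f) (hf01 : ∀ z, f z ∈ Set.Icc (0 : ℝ) 1) :
    MemLp (fun z : κ → Z => (1 / (I.card : ℝ)) * ∑ i ∈ I, f (z i)) 2 (Measure.pi ν) :=
  (memLp_finsetSum I fun i _ => memLp_coordinate ν hf hf01 i).const_mul _

lemma variance_average_le (hf : Measurable f) (hf01 : ∀ z, f z ∈ Set.Icc (0 : ℝ) 1) :
    variance (fun z : κ → Z => (1 / (I.card : ℝ)) * ∑ i ∈ I, f (z i)) (Measure.pi ν) ≤
      1 / (4 * I.card) := by
  have hindep : iIndepFun (fun i (z : κ → Z) => f (z i)) (Measure.pi ν) :=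
    iIndepFun_pi fun _ => hf.aemeasurable
  have hsum : (fun z : κ → Z => ∑ i ∈ I, f (z i)) = ∑ i ∈ I, fun z : κ → Z => f (z i) := by
    ext z
    simp
  rw [variance_const_mul, hsum, IndepFun.variance_sum
    (fun i _ => memLp_coordinate ν hf hf01 i) fun i _ j _ hij => hindep.indepFun hij]
  calc _ ≤ (1 / (I.card : ℝ)) ^ 2 * ∑ _i ∈ I, ((1 - 0) / 2 : ℝ) ^ 2 := by
        gcongr with i
        exact variance_le_sq_of_bounded (ae_of_all _ fun z => hf01 (z i))
          (hf.comp (measurable_pi_apply i)).aemeasurable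
    _ = 1 / (4 * I.card) := by
        rcases I.eq_empty_or_nonempty with rfl | hI
        · simp
        have := hI.card_pos
        simp only [Finset.sum_const, nsmul_eq_mul]
        field_simp
        norm_num

lemma integral_average (hI : I.Nonempty) (hf : Measurable f)
    (hf01 : ∀ z, f z ∈ Set.Icc (0 : ℝ) 1) {p : ℝ} (hp : ∀ i ∈ I, ∫ z, f z ∂(ν i) = p) :
    ∫ z, (1 / (I.card : ℝ)) * ∑ i ∈ I, f (z i) ∂(Measure.pi ν) = p := by
  have hcoord : ∀ i ∈ I, ∫ z, f (z i) ∂(Measure.pi ν) = p := fun i hi =>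
    (integral_comp_of_measurePreserving (measurePreserving_eval ν i)
      hf.aestronglyMeasurable).trans (hp i hi)
  have := hI.card_pos
  rw [integral_const_mul, integral_finsetSum _ fun i _ =>
    (memLp_coordinate ν hf hf01 i).integrable one_le_two, Finset.sum_congr rfl hcoord,
    Finset.sum_const, nsmul_eq_mul]
  field_simp

lemma integral_abs_average_sub_le (hI : I.Nonempty) (hf : Measurable f)
    (hf01 : ∀ z, f z ∈ Set.Icc (0 : ℝ) 1) {p : ℝ} (hp : ∀ i ∈ I, ∫ z, f z ∂(ν i) = p) :
    ∫ z, |(1 / (I.card : ℝ)) * (∑ i ∈ I, f (z i)) - p| ∂(Measure.pi ν) ≤ 1 / √I.card := by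
  have hdev := integral_abs_sub_integral_le_sqrt_variance (memLp_average ν (I := I) hf hf01)
  rw [integral_average ν hI hf hf01 hp] at hdev
  calc _ ≤ √(1 / (4 * I.card)) := hdev.trans (Real.sqrt_le_sqrt (variance_average_le ν hf hf01))
    _ ≤ √(1 / I.card) := by
        have := hI.card_pos
        gcongr
        linarith
    _ = 1 / √I.card := by rw [Real.sqrt_div zero_le_one, Real.sqrt_one]

end Averages

section LipschitzDeviation

variable {κ X : Type*} [MetricSpace X]

lemma abs_sub_le_dist {f : X → ℝ} (hf : LipschitzWith 1 f) (x y : X) : |f x - f y| ≤ dist x y := by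
  simpa [Real.dist_eq] using hf.dist_le_mul x y

variable [MeasurableSpace X]

/-- The one-sided deviation of the averages of `1`-Lipschitz functions over the points `x i`,
`i ∈ I`, from their integrals with respect to `μ`. -/
def lipDev (μ : Measure X) (I : Finset κ) (x : κ → X) : ℝ :=
  ⨆ f : {f : X → ℝ // LipschitzWith 1 f},
    ((1 / (I.card : ℝ)) * (∑ i ∈ I, f.1 (x i)) - ∫ x, f.1 x ∂μ)

variable [OpensMeasurableSpace X] (μ : Measure X) [IsProbabilityMeasure μ] {D : ℝ≥0}
  (hD : ∀ x y : X, dist x y ≤ D)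

include hD

lemma integrable_of_lipschitz {K : ℝ≥0} {f : X → ℝ} (hf : LipschitzWith K f) : Integrable f μ := by
  have := nonempty_of_isProbabilityMeasure μ
  let x₀ : X := Classical.ofNonempty
  refine ((integrable_const (|f x₀| + K * D)).mono' hf.continuous.measurable.aestronglyMeasurable
    (ae_of_all _ fun x => ?_))
  have hdist : |f x - f x₀| ≤ K * D :=
    (hf.dist_le_mul x x₀).trans (mul_le_mul_of_nonneg_left (hD x x₀) K.2)
  rw [Real.norm_eq_abs]
  linarith [abs_sub_abs_le_abs_sub (f x) (f x₀)]

lemma abs_lipschitz_sub_integral_le {f : X → ℝ} (hf : LipschitzWith 1 f) (y : X) :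
    |f y - ∫ x, f x ∂μ| ≤ D := by
  have hsub : f y - ∫ x, f x ∂μ = ∫ x, (f y - f x) ∂μ := by
    rw [integral_sub (integrable_const _) (integrable_of_lipschitz μ hD hf), integral_const,
      probReal_univ, one_smul]
  rw [hsub]
  exact abs_integral_le_of_abs_le μ fun x => (abs_sub_le_dist hf y x).trans (hD y x)

lemma abs_lipschitz_average_sub_le {f : X → ℝ} (hf : LipschitzWith 1 f) {I : Finset κ}
    (hI : I.Nonempty) (x : κ → X) :
    |(1 / (I.card : ℝ)) * (∑ i ∈ I, f (x i)) - ∫ x, f x ∂μ| ≤ D := by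
  have := hI.card_pos
  have hsub : (1 / (I.card : ℝ)) * (∑ i ∈ I, f (x i)) - ∫ x, f x ∂μ =
      (1 / (I.card : ℝ)) * ∑ i ∈ I, (f (x i) - ∫ x, f x ∂μ) := by
    rw [Finset.sum_sub_distrib, Finset.sum_const, nsmul_eq_mul]
    field_simp
  rw [hsub, abs_mul, abs_of_nonneg (by positivity)]
  calc _ ≤ (1 / (I.card : ℝ)) * ∑ _i ∈ I, (D : ℝ) := by
        gcongr
        exact (Finset.abs_sum_le_sum_abs _ _).trans
          (Finset.sum_le_sum fun i _ => abs_lipschitz_sub_integral_le μ hD hf _)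
    _ = D := by
        rw [Finset.sum_const, nsmul_eq_mul]
        field_simp

section Nonempty

variable {I : Finset κ} (hI : I.Nonempty)

include hI

lemma bddAbove_range_lipschitz_average_sub (x : κ → X) :
    BddAbove (Set.range fun f : {f : X → ℝ // LipschitzWith 1 f} =>
      (1 / (I.card : ℝ)) * (∑ i ∈ I, f.1 (x i)) - ∫ x, f.1 x ∂μ) :=
  bddAbove_range_of_abs_le fun f => abs_lipschitz_average_sub_le μ hD f.2 hI x

lemma average_sub_integral_le_lipDev {f : X → ℝ} (hf : LipschitzWith 1 f) (x : κ → X) :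
    (1 / (I.card : ℝ)) * (∑ i ∈ I, f (x i)) - ∫ x, f x ∂μ ≤ lipDev μ I x :=
  le_ciSup (bddAbove_range_lipschitz_average_sub μ hD hI x) ⟨f, hf⟩

lemma abs_lipDev_le (x : κ → X) : |lipDev μ I x| ≤ D :=
  abs_iSup_le fun f => abs_lipschitz_average_sub_le μ hD f.2 hI x

lemma lipDev_update_sub_le [DecidableEq κ] (i : κ) (x : κ → X) (y : X) :
    lipDev μ I (Function.update x i y) - lipDev μ I x ≤
      (if i ∈ I then D / I.card else 0 : ℝ≥0) := by
  refine iSup_sub_iSup_le (bddAbove_range_lipschitz_average_sub μ hD hI x) fun f => ?_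
  rw [sub_sub_sub_cancel_right, ← mul_sub]
  split_ifs with hi
  · rw [sum_comp_update_sub f.1 hi]
    calc 1 / (I.card : ℝ) * (f.1 y - f.1 (x i)) ≤ 1 / (I.card : ℝ) * D := by
          gcongr
          exact (le_abs_self _).trans ((abs_sub_le_dist f.2 _ _).trans (hD _ _))
      _ = (D / I.card : ℝ≥0) := by
          push_cast
          ring
  · refine (mul_eq_zero_of_right _ (sub_eq_zero.2 (Finset.sum_congr rfl fun j hj => ?_))).le
    rw [Function.update_of_ne (ne_of_mem_of_not_mem hj hi)]

lemma measurable_lipDev [SecondCountableTopology X] [Countable κ] : Measurable (lipDev μ I) :=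
  measurable_iSup_of_continuous (fun f => by have := f.2.continuous; fun_prop)
    (bddAbove_range_lipschitz_average_sub μ hD hI)

end Nonempty

lemma measureReal_lipDev_gt_le [SecondCountableTopology X] {n : ℕ} (ν : Fin n → Measure X)
    [∀ i, IsProbabilityMeasure (ν i)] {I : Finset (Fin n)} (hI : I.Nonempty) {m : ℝ}
    (hm : ∫ x, lipDev μ I x ∂(Measure.pi ν) ≤ m) {δ : ℝ} (hδ : 0 < δ) :
    (Measure.pi ν).real
      {x | m + D * √((1 / 2) * Real.log (1 / δ)) * √(1 / (I.card : ℝ)) < lipDev μ I x} ≤ δ := by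
  have := hI.card_pos
  have hvar : (∑ i, ((if i ∈ I then D / I.card else 0 : ℝ≥0) : ℝ) ^ 2) / 2 * Real.log (1 / δ) =
      D ^ 2 * ((1 / 2) * Real.log (1 / δ) * (1 / (I.card : ℝ))) := by
    have hsum : ∑ i, ((if i ∈ I then D / I.card else 0 : ℝ≥0) : ℝ) ^ 2 = D ^ 2 / I.card := by
      simp [apply_ite]
      field_simp
    rw [hsum]
    ring
  have htail := measureReal_gt_le_of_bounded_differences ν (measurable_lipDev μ hD hI)
    (abs_lipDev_le μ hD hI) _ (lipDev_update_sub_le μ hD hI) hm hδ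
  rwa [hvar, Real.sqrt_mul (by positivity), Real.sqrt_sq D.coe_nonneg,
    Real.sqrt_mul' _ (by positivity), ← mul_assoc] at htail

end LipschitzDeviation

section Quantization

variable {κ X : Type*} [MeasurableSpace X]

/-- The deviation of the frequency of the cell `q ⁻¹' {c}` of the quantizer `q` among the points
`x i`, `i ∈ I`, from its probability under `μ`. -/
def cellDev (μ : Measure X) (q : SimpleFunc X X) (I : Finset κ) (x : κ → X) (c : X) : ℝ :=
  (1 / (I.card : ℝ)) * (∑ i ∈ I, (q ⁻¹' {c}).indicator 1 (x i)) - μ.real (q ⁻¹' {c})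

lemma comp_simpleFunc_eq_sum_indicator (q : SimpleFunc X X) (F : X → ℝ) (x : X) :
    F (q x) = ∑ c ∈ q.range, F c * (q ⁻¹' {c}).indicator 1 x := by
  rw [Finset.sum_eq_single_of_mem (q x) (q.mem_range_self x)]
  · simp
  · intro c _ hc
    simp [Ne.symm hc]

lemma integrable_cell (μ : Measure X) [IsFiniteMeasure μ] (q : SimpleFunc X X) (c : X) :
    Integrable ((q ⁻¹' {c}).indicator (1 : X → ℝ)) μ :=
  (integrable_const (1 : ℝ)).indicator (q.measurableSet_fiber c)

lemma integrable_comp_simpleFunc (μ : Measure X) [IsFiniteMeasure μ] (q : SimpleFunc X X)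
    (F : X → ℝ) : Integrable (fun x => F (q x)) μ := by
  simp only [comp_simpleFunc_eq_sum_indicator q F]
  exact integrable_finsetSum _ fun c _ => (integrable_cell μ q c).const_mul _

lemma average_comp_sub_integral_comp (μ : Measure X) [IsFiniteMeasure μ] (q : SimpleFunc X X)
    (F : X → ℝ) (I : Finset κ) (x : κ → X) :
    (1 / (I.card : ℝ)) * (∑ i ∈ I, F (q (x i))) - ∫ y, F (q y) ∂μ =
      ∑ c ∈ q.range, F c * cellDev μ q I x c := by
  simp only [comp_simpleFunc_eq_sum_indicator q F, cellDev, mul_sub, Finset.sum_sub_distrib]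
  congr 1
  · rw [Finset.sum_comm, Finset.mul_sum]
    refine Finset.sum_congr rfl fun c _ => ?_
    rw [← Finset.mul_sum]
    ring
  · rw [integral_finsetSum _ fun c _ => (integrable_cell μ q c).const_mul _]
    refine Finset.sum_congr rfl fun c _ => ?_
    rw [integral_const_mul, integral_indicator_one (q.measurableSet_fiber c)]

lemma sum_cellDev_eq_zero (μ : Measure X) [IsProbabilityMeasure μ] (q : SimpleFunc X X)
    {I : Finset κ} (hI : I.Nonempty) (x : κ → X) : ∑ c ∈ q.range, cellDev μ q I x c = 0 := by
  have := hI.card_pos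
  have h := average_comp_sub_integral_comp μ q (fun _ => 1) I x
  simp only [one_mul] at h
  rw [← h]
  simp only [Finset.sum_const, nsmul_eq_mul, integral_const, probReal_univ, one_smul]
  field_simp
  simp

lemma integral_abs_cellDev_le {μ : Measure X} [Fintype κ] (q : SimpleFunc X X)
    (ν : κ → Measure X) [∀ i, IsProbabilityMeasure (ν i)] {I : Finset κ} (hI : I.Nonempty)
    (hν : ∀ i ∈ I, ν i = μ) (c : X) :
    ∫ x, |cellDev μ q I x c| ∂(Measure.pi ν) ≤ 1 / √I.card := by
  refine integral_abs_average_sub_le ν hI (measurable_one.indicator (q.measurableSet_fiber c))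
    (fun x => ?_) fun i hi => ?_
  · by_cases hx : x ∈ q ⁻¹' {c} <;> simp [hx]
  · rw [hν i hi, integral_indicator_one (q.measurableSet_fiber c)]

lemma integrable_cellDev (μ : Measure X) [Fintype κ] (q : SimpleFunc X X)
    (ν : κ → Measure X) [∀ i, IsProbabilityMeasure (ν i)] (I : Finset κ) (c : X) :
    Integrable (fun x => cellDev μ q I x c) (Measure.pi ν) := by
  have hcell : ∀ i, Integrable (fun x : κ → X => (q ⁻¹' {c}).indicator (1 : X → ℝ) (x i))
      (Measure.pi ν) := fun i =>
    (measurePreserving_eval ν i).integrable_comp_of_integrable (integrable_cell (ν i) q c)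
  exact ((integrable_finsetSum _ fun i _ => hcell i).const_mul _).sub (integrable_const _)

end Quantization

section QuantizedDeviation

variable {κ X : Type*} [MetricSpace X] [MeasurableSpace X] [OpensMeasurableSpace X]
  (μ : Measure X) [IsProbabilityMeasure μ] {D : ℝ≥0} (hD : ∀ x y : X, dist x y ≤ D)
  {q : SimpleFunc X X} {ε : ℝ} (hq : ∀ x, dist (q x) x ≤ ε) {I : Finset κ} (hI : I.Nonempty)

include hD hq hI

lemma lipschitz_average_sub_integral_le {f : X → ℝ} (hf : LipschitzWith 1 f) (x : κ → X) :
    (1 / (I.card : ℝ)) * (∑ i ∈ I, f (x i)) - ∫ y, f y ∂μ ≤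
      2 * ε + ∑ c ∈ q.range, f c * cellDev μ q I x c := by
  have hfq : ∀ y, |f (q y) - f y| ≤ ε := fun y => (abs_sub_le_dist hf _ _).trans (hq y)
  have havg : (1 / (I.card : ℝ)) * ∑ i ∈ I, f (x i) ≤
      (1 / (I.card : ℝ)) * (∑ i ∈ I, f (q (x i))) + ε := by
    have := hI.card_pos
    calc (1 / (I.card : ℝ)) * ∑ i ∈ I, f (x i)
        ≤ (1 / (I.card : ℝ)) * ∑ i ∈ I, (f (q (x i)) + ε) := by
          gcongr with i
          linarith [(abs_le.1 (hfq (x i))).1]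
      _ = (1 / (I.card : ℝ)) * (∑ i ∈ I, f (q (x i))) + ε := by
          rw [Finset.sum_add_distrib, Finset.sum_const, nsmul_eq_mul]
          field_simp
  have hint : ∫ y, f (q y) ∂μ - ∫ y, f y ∂μ ≤ ε := by
    rw [← integral_sub (integrable_comp_simpleFunc μ q f) (integrable_of_lipschitz μ hD hf)]
    exact (le_abs_self _).trans (abs_integral_le_of_abs_le μ hfq)
  linarith [average_comp_sub_integral_comp μ q f I x]

lemma lipDev_le_of_quantizer (x : κ → X) :
    lipDev μ I x ≤ 2 * ε + D * ∑ c ∈ q.range, |cellDev μ q I x c| := by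
  have : Nonempty {f : X → ℝ // LipschitzWith 1 f} := ⟨⟨fun _ => 0, LipschitzWith.const' 0⟩⟩
  obtain ⟨i₀, -⟩ := hI.exists_mem
  refine ciSup_le fun ⟨f, hf⟩ => (lipschitz_average_sub_integral_le μ hD hq hI hf x).trans ?_
  have hcenter : ∑ c ∈ q.range, f c * cellDev μ q I x c =
      ∑ c ∈ q.range, (f c - f (x i₀)) * cellDev μ q I x c := by
    simp_rw [sub_mul, Finset.sum_sub_distrib, ← Finset.mul_sum, sum_cellDev_eq_zero μ q hI x,
      mul_zero, sub_zero]
  rw [hcenter, Finset.mul_sum]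
  refine add_le_add le_rfl (Finset.sum_le_sum fun c _ => ?_)
  calc (f c - f (x i₀)) * cellDev μ q I x c ≤ |f c - f (x i₀)| * |cellDev μ q I x c| :=
        (le_abs_self _).trans_eq (abs_mul _ _)
    _ ≤ D * |cellDev μ q I x c| := by
        gcongr
        exact (abs_sub_le_dist hf _ _).trans (hD _ _)

lemma integral_lipDev_le_of_quantizer [SecondCountableTopology X] [Fintype κ] (ν : κ → Measure X)
    [∀ i, IsProbabilityMeasure (ν i)] (hν : ∀ i ∈ I, ν i = μ) :
    ∫ x, lipDev μ I x ∂(Measure.pi ν) ≤ 2 * ε + D * (q.range.card * (1 / √I.card)) := by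
  have hcell : Integrable (fun x => ∑ c ∈ q.range, |cellDev μ q I x c|) (Measure.pi ν) :=
    integrable_finsetSum _ fun c _ => (integrable_cellDev μ q ν I c).abs
  calc _ ≤ ∫ x, (2 * ε + D * ∑ c ∈ q.range, |cellDev μ q I x c|) ∂(Measure.pi ν) :=
        integral_mono (Integrable.of_bound (measurable_lipDev μ hD hI).aestronglyMeasurable D
          (ae_of_all _ (abs_lipDev_le μ hD hI))) ((integrable_const _).add (hcell.const_mul _))
          (lipDev_le_of_quantizer μ hD hq hI)
    _ = 2 * ε + D * ∑ c ∈ q.range, ∫ x, |cellDev μ q I x c| ∂(Measure.pi ν) := by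
        rw [integral_add (integrable_const _) (hcell.const_mul _), integral_const,
          probReal_univ, one_smul, integral_const_mul,
          integral_finsetSum _ fun c _ => (integrable_cellDev μ q ν I c).abs]
    _ ≤ 2 * ε + D * ∑ _c ∈ q.range, 1 / √I.card := by
        gcongr with c
        exact integral_abs_cellDev_le q ν hI hν c
    _ = 2 * ε + D * (q.range.card * (1 / √I.card)) := by
        rw [Finset.sum_const, nsmul_eq_mul]

end QuantizedDeviation

section Covering

/-- `X` can be covered by polynomially many balls of radius `ε` as `ε → 0`. -/
def HasPolynomialCovering (X : Type*) [MetricSpace X] : Prop :=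
  ∃ A p : ℝ≥0, ∀ ε : ℝ, 0 < ε → ε ≤ 1 →
    ∃ s : Finset X, (s.card : ℝ) ≤ A * ε ^ (-(p : ℝ)) ∧ ∀ x, ∃ c ∈ s, dist x c ≤ ε

lemma HasPolynomialCovering.totallyBounded {X : Type*} [MetricSpace X]
    (hX : HasPolynomialCovering X) : TotallyBounded (Set.univ : Set X) := by
  obtain ⟨A, p, hcov⟩ := hX
  refine Metric.totallyBounded_iff.2 fun ε hε => ?_
  obtain ⟨s, -, hs⟩ := hcov (min (ε / 2) 1) (by positivity) (min_le_right _ _)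
  refine ⟨s, s.finite_toSet, fun x _ => ?_⟩
  obtain ⟨c, hc, hxc⟩ := hs x
  refine Set.mem_iUnion₂.2 ⟨c, hc, hxc.trans_lt ((min_le_left _ _).trans_lt (by linarith))⟩

lemma HasPolynomialCovering.dist_le_diam {X : Type*} [MetricSpace X]
    (hX : HasPolynomialCovering X) (x y : X) : dist x y ≤ Metric.diam (Set.univ : Set X) :=
  Metric.dist_le_diam_of_mem hX.totallyBounded.isBounded (Set.mem_univ x) (Set.mem_univ y)

lemma HasPolynomialCovering.secondCountableTopology {X : Type*} [MetricSpace X]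
    (hX : HasPolynomialCovering X) : SecondCountableTopology X :=
  have : TopologicalSpace.SeparableSpace X :=
    TopologicalSpace.isSeparable_univ_iff.1 hX.totallyBounded.isSeparable
  UniformSpace.secondCountable_of_separable X

lemma exists_simpleFunc_dist_le {X : Type*} [MetricSpace X] [MeasurableSpace X]
    [OpensMeasurableSpace X] [Nonempty X] {s : Finset X} {ε : ℝ}
    (hs : ∀ x, ∃ c ∈ s, dist x c ≤ ε) :
    ∃ q : SimpleFunc X X, q.range ⊆ s ∧ ∀ x, dist (q x) x ≤ ε := by
  have hne : (s : Set X).Nonempty := by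
    obtain ⟨c, hc, -⟩ := hs Classical.ofNonempty
    exact ⟨c, hc⟩
  obtain ⟨e, he⟩ := s.countable_toSet.exists_eq_range hne
  have hidx : ∀ c ∈ s, ∃ n, e n = c := fun c hc => by
    have : c ∈ Set.range e := he ▸ hc
    exact this
  choose! idx hidx using hidx
  refine ⟨SimpleFunc.nearestPt e (s.sup idx), fun c hc => ?_, fun x => ?_⟩
  · obtain ⟨x, rfl⟩ := SimpleFunc.mem_range.1 hc
    exact Finset.mem_coe.1 (he ▸ Set.mem_range_self _)
  · obtain ⟨c, hc, hxc⟩ := hs x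
    have h := SimpleFunc.edist_nearestPt_le e x (Finset.le_sup (f := idx) hc)
    rw [hidx c hc, edist_dist, edist_dist, ENNReal.ofReal_le_ofReal_iff dist_nonneg,
      dist_comm c x] at h
    exact h.trans hxc

/-- Over `k` points of `X` the expected deviation `lipDev` is at most `C * k ^ (-1 / s)`. The
points need not all have the same law: only those that enter the deviation do. -/
def HasLipDevRate (X : Type*) [MetricSpace X] [MeasurableSpace X] (C s : ℝ) : Prop :=
  ∀ (μ : Measure X) [IsProbabilityMeasure μ] (n : ℕ) (ν : Fin n → Measure X)
    [∀ i, IsProbabilityMeasure (ν i)] (I : Finset (Fin n)), I.Nonempty → (∀ i ∈ I, ν i = μ) →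
    ∫ x, lipDev μ I x ∂(Measure.pi ν) ≤ C * (I.card : ℝ) ^ (-(1 / s))

-- The radius `k ^ (-1 / (2 * p + 3))` makes the number of cells negligible against `√k`.
lemma rpow_neg_mul_one_div_sqrt_le {k p : ℝ} (hk : 1 ≤ k) (hp : 0 ≤ p) :
    (k ^ (-(1 / (2 * p + 3)))) ^ (-p) * (1 / √k) ≤ k ^ (-(1 / (2 * p + 3))) := by
  have hk0 : 0 < k := zero_lt_one.trans_le hk
  rw [Real.sqrt_eq_rpow, one_div (k ^ (1 / 2 : ℝ)), ← Real.rpow_neg hk0.le,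
    ← Real.rpow_mul hk0.le, ← Real.rpow_add hk0]
  refine Real.rpow_le_rpow_of_exponent_le hk ?_
  field_simp
  linarith

lemma HasPolynomialCovering.exists_hasLipDevRate {X : Type*} [MetricSpace X] [MeasurableSpace X]
    [OpensMeasurableSpace X] (hX : HasPolynomialCovering X) :
    ∃ C s : ℝ, 0 ≤ C ∧ 2 < s ∧ HasLipDevRate X C s := by
  have := hX.secondCountableTopology
  let D : ℝ≥0 := ⟨Metric.diam (Set.univ : Set X), Metric.diam_nonneg⟩
  have hD : ∀ x y : X, dist x y ≤ D := hX.dist_le_diam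
  obtain ⟨A, p, hcov⟩ := hX
  refine ⟨2 + D * A, 2 * p + 3, by positivity, by linarith [p.coe_nonneg],
    fun μ _ n ν _ I hI hν => ?_⟩
  have := nonempty_of_isProbabilityMeasure μ
  have hk : (1 : ℝ) ≤ I.card := by exact_mod_cast hI.card_pos
  set ε : ℝ := (I.card : ℝ) ^ (-(1 / (2 * (p : ℝ) + 3)))
  have hε1 : ε ≤ 1 :=
    Real.rpow_le_one_of_one_le_of_nonpos hk (neg_nonpos.2 (by positivity))
  obtain ⟨s, hcard, hs⟩ := hcov ε (by positivity) hε1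
  obtain ⟨q, hqs, hq⟩ := exists_simpleFunc_dist_le hs
  calc ∫ x, lipDev μ I x ∂(Measure.pi ν) ≤ 2 * ε + D * (q.range.card * (1 / √I.card)) :=
        integral_lipDev_le_of_quantizer μ hD hq hI ν hν
    _ ≤ 2 * ε + D * (A * ε ^ (-(p : ℝ)) * (1 / √I.card)) := by
        gcongr
        exact (Nat.cast_le.2 (Finset.card_le_card hqs)).trans hcard
    _ = 2 * ε + D * A * (ε ^ (-(p : ℝ)) * (1 / √I.card)) := by ring
    _ ≤ 2 * ε + D * A * ε := by
        gcongr
        exact rpow_neg_mul_one_div_sqrt_le hk p.coe_nonneg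
    _ = (2 + D * A) * ε := by ring

end Covering

section EuclideanCovering

variable {d : ℕ} {X : Set (EuclideanSpace ℝ (Fin d))}

lemma dist_le_of_floor_div_eq {η : ℝ} (hη : 0 < η) {x y : EuclideanSpace ℝ (Fin d)}
    (hxy : ∀ j, ⌊x j / η⌋ = ⌊y j / η⌋) : dist x y ≤ √d * η := by
  have hj : ∀ j, dist (x j) (y j) ≤ η := fun j => by
    have h := Int.abs_sub_lt_one_of_floor_eq_floor (hxy j)
    rw [← sub_div, abs_div, abs_of_pos hη, div_lt_one hη] at h
    exact h.le
  rw [EuclideanSpace.dist_eq]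
  calc √(∑ j, dist (x j) (y j) ^ 2) ≤ √(∑ _j : Fin d, η ^ 2) := by
        gcongr with j
        exact hj j
    _ = √d * η := by simp [Real.sqrt_sq hη.le]

lemma card_Icc_floor_le {R η : ℝ} (hR : 0 ≤ R) (hη : 0 < η) :
    ((Finset.Icc ⌊-R / η⌋ ⌊R / η⌋).card : ℝ) ≤ 2 * (R / η) + 2 := by
  have hle : ⌊-R / η⌋ ≤ ⌊R / η⌋ := Int.floor_le_floor (by gcongr; linarith)
  rw [← Int.cast_natCast, Int.card_Icc_of_le _ _ (by lia)]
  push_cast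
  have hup := Int.floor_le (R / η)
  have hlow := Int.lt_floor_add_one (-R / η)
  rw [neg_div] at hlow ⊢
  linarith

lemma exists_finset_card_le_dist_le_of_norm_le {R η : ℝ} (hX : ∀ x ∈ X, ‖x‖ ≤ R) (hR : 0 ≤ R)
    (hη : 0 < η) :
    ∃ s : Finset X, (s.card : ℝ) ≤ (2 * (R / η) + 2) ^ d ∧ ∀ x, ∃ c ∈ s, dist x c ≤ √d * η := by
  classical
  rcases isEmpty_or_nonempty X with hX₀ | hX₀
  · exact ⟨∅, by rw [Finset.card_empty, Nat.cast_zero]; positivity, fun x => hX₀.elim x⟩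
  let π : X → Fin d → ℤ := fun x j => ⌊x.1 j / η⌋
  let cells : Finset (Fin d → ℤ) := Fintype.piFinset fun _ => Finset.Icc ⌊-R / η⌋ ⌊R / η⌋
  have hπ : ∀ x, π x ∈ cells := fun x => Fintype.mem_piFinset.2 fun j => by
    have hxj := abs_le.1 ((PiLp.norm_apply_le x.1 j).trans (hX _ x.2))
    exact Finset.mem_Icc.2 ⟨Int.floor_le_floor (by gcongr; exact hxj.1),
      Int.floor_le_floor (by gcongr; exact hxj.2)⟩
  refine ⟨cells.image (Function.invFun π), ?_, fun x => ⟨_, Finset.mem_image_of_mem _ (hπ x),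
    dist_le_of_floor_div_eq hη fun j => ?_⟩⟩
  · calc ((cells.image (Function.invFun π)).card : ℝ) ≤ cells.card := by
          exact_mod_cast Finset.card_image_le
      _ = ((Finset.Icc ⌊-R / η⌋ ⌊R / η⌋).card : ℝ) ^ d := by simp [cells]
      _ ≤ (2 * (R / η) + 2) ^ d := by
          gcongr
          exact card_Icc_floor_le hR hη
  · exact (congrFun (Function.invFun_eq (f := π) ⟨x, rfl⟩) j).symm

lemma hasPolynomialCovering_of_isBounded (hX : Bornology.IsBounded X) :
    HasPolynomialCovering X := by
  obtain ⟨R, hR0, hR⟩ := hX.exists_pos_norm_le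
  refine ⟨⟨(2 * R * (√d + 1) + 2) ^ d, by positivity⟩, d, fun ε hε hε1 => ?_⟩
  obtain ⟨s, hcard, hs⟩ :=
    exists_finset_card_le_dist_le_of_norm_le hR hR0.le (η := ε / (√d + 1)) (by positivity)
  refine ⟨s, hcard.trans ?_, fun x => ?_⟩
  · rw [NNReal.coe_natCast, Real.rpow_neg hε.le, Real.rpow_natCast, ← div_eq_mul_inv]
    calc (2 * (R / (ε / (√d + 1))) + 2) ^ d ≤ ((2 * R * (√d + 1) + 2) / ε) ^ d := by
          gcongr
          field_simp
          linarith
      _ = (2 * R * (√d + 1) + 2) ^ d / ε ^ d := div_pow _ _ _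
  · obtain ⟨c, hc, hxc⟩ := hs x
    refine ⟨c, hc, hxc.trans ?_⟩
    field_simp
    linarith

end EuclideanCovering

section Conditioning

-- Law of total probability over the values of `f`.
lemma measureReal_le_of_forall_cond_le {Ω V : Type*} [MeasurableSpace Ω] [Finite V]
    [MeasurableSpace V] [MeasurableSingletonClass V] (P : Measure Ω) [IsProbabilityMeasure P]
    {f : Ω → V} (hf : Measurable f) {A : Set Ω} {δ : ℝ}
    (h : ∀ v, P (f ⁻¹' {v}) ≠ 0 → (P[|f ⁻¹' {v}]).real A ≤ δ) : P.real A ≤ δ := by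
  have := Fintype.ofFinite V
  have htotal : P.real A = ∑ v, P.real (f ⁻¹' {v}) * (P[|f ⁻¹' {v}]).real A := by
    have hsum : P A = ∑ v, P (f ⁻¹' {v}) * P[|f ⁻¹' {v}] A := by
      simpa [Measure.coe_finsetSum] using (congrArg (· A) (sum_meas_smul_cond_fiber hf P)).symm
    rw [Measure.real, hsum, ENNReal.toReal_sum fun v _ =>
      ENNReal.mul_ne_top (measure_ne_top _ _) (measure_ne_top _ _)]
    simp only [ENNReal.toReal_mul, Measure.real]
  have hmass : ∑ v, P.real (f ⁻¹' {v}) = 1 := by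
    rw [sum_measureReal_preimage_singleton _ fun v _ => hf (measurableSet_singleton v)]
    simp
  rw [htotal, ← one_mul δ, ← hmass, Finset.sum_mul]
  refine Finset.sum_le_sum fun v _ => ?_
  rcases eq_or_ne (P (f ⁻¹' {v})) 0 with hv | hv
  · simp [Measure.real, hv]
  · exact mul_le_mul_of_nonneg_left (h v hv) measureReal_nonneg

lemma cond_univ_pi {ι : Type*} [Fintype ι] {Z : ι → Type*} [∀ i, MeasurableSpace (Z i)]
    (μ : ∀ i, Measure (Z i)) [∀ i, IsFiniteMeasure (μ i)] {s : ∀ i, Set (Z i)}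
    (hs : ∀ i, μ i (s i) ≠ 0) :
    (Measure.pi μ)[|Set.univ.pi s] = Measure.pi fun i => (μ i)[|s i] := by
  have := fun i => cond_isProbabilityMeasure (hs i)
  refine (Measure.pi_eq fun t _ => ?_).symm
  simp only [ProbabilityTheory.cond, Measure.smul_apply, smul_eq_mul, Measure.restrict_pi_pi,
    Measure.pi_pi, Finset.prod_mul_distrib]
  rw [ENNReal.prod_inv_distrib fun i _ j _ _ => Or.inl (hs i)]

end Conditioning

section ClassConditional

variable {X Y : Type*} [MeasurableSpace X] [MeasurableSpace Y]

/-- The conditional law of `x` given the label `y`. -/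
def condLaw (Q : Measure (X × Y)) (y : Y) : Measure X := (Q[|{p | p.2 = y}]).map Prod.fst

/-- The indices of the points of the sample `z` with label `y`. -/
def classIdx [DecidableEq Y] {n : ℕ} (z : Fin n → X × Y) (y : Y) : Finset (Fin n) :=
  Finset.univ.filter fun i => (z i).2 = y

/-- The deviation `lipDev` of the points of the sample `z` with label `y` from the conditional
law of that label. -/
def classDev [MetricSpace X] [DecidableEq Y] (Q : Measure (X × Y)) {n : ℕ} (z : Fin n → X × Y)
    (y : Y) : ℝ :=
  lipDev (condLaw Q y) (classIdx z y) fun i => (z i).1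

/-- The radius that the deviation from a law of diameter `D` exceeds with probability at most `δ`
over `k` points, if its expectation decays at the rate `C * k ^ (-1 / s)`. -/
def classRadius (C s D δ : ℝ) (k : ℕ) : ℝ :=
  C * (k : ℝ) ^ (-(1 / s)) + D * √((1 / 2) * Real.log (1 / δ)) * √(1 / (k : ℝ))

lemma isProbabilityMeasure_condLaw (Q : Measure (X × Y)) [IsFiniteMeasure Q] {y : Y}
    (hy : Q {p | p.2 = y} ≠ 0) : IsProbabilityMeasure (condLaw Q y) :=
  have := cond_isProbabilityMeasure hy
  Measure.isProbabilityMeasure_map measurable_fst.aemeasurable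

lemma measurePreserving_pi_cond_label (Q : Measure (X × Y)) [IsFiniteMeasure Q] {n : ℕ}
    {v : Fin n → Y} (hv : ∀ i, Q {p | p.2 = v i} ≠ 0) :
    MeasurePreserving (fun (z : Fin n → X × Y) i => (z i).1)
      ((Measure.pi fun _ => Q)[|(fun z i => (z i).2) ⁻¹' {v}])
      (Measure.pi fun i => condLaw Q (v i)) := by
  have := fun i => cond_isProbabilityMeasure (hv i)
  have := fun i => isProbabilityMeasure_condLaw Q (hv i)
  have hfiber : (fun (z : Fin n → X × Y) i => (z i).2) ⁻¹' {v} =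
      Set.univ.pi fun i => {p | p.2 = v i} := by
    ext z
    simp [funext_iff]
  rw [hfiber, cond_univ_pi _ hv]
  exact measurePreserving_pi _ _ fun i => ⟨measurable_fst, rfl⟩

variable [MeasurableSingletonClass Y] [MetricSpace X] [OpensMeasurableSpace X]
  [SecondCountableTopology X] [DecidableEq Y] {D : ℝ≥0}
  (hD : ∀ x y : X, dist x y ≤ D) {C s : ℝ} (hrate : HasLipDevRate X C s) (Q : Measure (X × Y))
  [IsProbabilityMeasure Q] {y : Y} {n : ℕ} {δ : ℝ} (hδ : 0 < δ)

include hD hrate hδ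

lemma cond_labels_classDev_gt_le {v : Fin n → Y} (hv : ∀ i, Q {p | p.2 = v i} ≠ 0) :
    ((Measure.pi fun _ : Fin n => Q)[|(fun z i => (z i).2) ⁻¹' {v}]).real {z |
      0 < classCount z y ∧ classRadius C s D δ (classCount z y) < classDev Q z y} ≤ δ := by
  have := fun i => isProbabilityMeasure_condLaw Q (hv i)
  have hproj := measurePreserving_pi_cond_label Q hv
  let I : Finset (Fin n) := Finset.univ.filter fun i => v i = y
  let bad : Set (Fin n → X) := {x | I.Nonempty ∧
    classRadius C s D δ I.card < lipDev (condLaw Q y) I x}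
  have hbad : MeasurableSet bad ∧ (Measure.pi fun i => condLaw Q (v i)).real bad ≤ δ := by
    by_cases hI : I.Nonempty
    · obtain ⟨i, hi⟩ := hI
      obtain rfl : v i = y := (Finset.mem_filter.1 hi).2
      have hI : I.Nonempty := ⟨i, hi⟩
      simp only [bad, hI, true_and]
      exact ⟨measurableSet_lt measurable_const (measurable_lipDev _ hD hI),
        measureReal_lipDev_gt_le _ hD _ hI (hrate _ n _ I hI fun i hi => by
          rw [(Finset.mem_filter.1 hi).2]) hδ⟩
    · simp [bad, hI, hδ.le]
  have hlabels : ∀ᵐ z ∂(Measure.pi fun _ : Fin n => Q)[|(fun z i => (z i).2) ⁻¹' {v}],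
      classIdx z y = I :=
    ae_cond_of_forall_mem (measurableSet_preimage (by fun_prop) (measurableSet_singleton v))
      fun z hz => Finset.filter_congr fun i _ => by rw [show (z i).2 = v i from congrFun hz i]
  calc _ = ((Measure.pi fun _ : Fin n => Q)[|(fun z i => (z i).2) ⁻¹' {v}]).real
        ((fun (z : Fin n → X × Y) i => (z i).1) ⁻¹' bad) := by
        refine measureReal_congr ?_
        filter_upwards [hlabels] with z hz
        refine propext (and_congr ?_ ?_)
        · rw [← hz]
          exact Finset.card_pos
        · rw [← hz]
          rfl
    _ ≤ δ := (hproj.measureReal_preimage hbad.1.nullMeasurableSet).trans_le hbad.2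

lemma measureReal_classDev_gt_le [Finite Y] :
    (Measure.pi fun _ : Fin n => Q).real {z | 0 < classCount z y ∧
      classRadius C s D δ (classCount z y) < classDev Q z y} ≤ δ := by
  refine measureReal_le_of_forall_cond_le (Measure.pi fun _ : Fin n => Q)
    (f := fun z i => (z i).2) (by fun_prop) fun v hv => ?_
  have hv' : ∀ i, Q {p | p.2 = v i} ≠ 0 := fun i hi => by
    have hnull : Measure.pi (fun _ : Fin n => Q) {z | (z i).2 = v i} = 0 :=
      (measurePreserving_eval (fun _ : Fin n => Q) i).quasiMeasurePreserving.preimage_null hi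
    exact hv (measure_mono_null (fun z hz => congrFun hz i) hnull)
  exact cond_labels_classDev_gt_le hD hrate Q hδ hv'

end ClassConditional

section LabelFrequencies

variable {X Y : Type*}

/-- The indicator of the label `y`. -/
def labelIndicator (y : Y) : X × Y → ℝ := {p | p.2 = y}.indicator 1

lemma labelIndicator_mem_Icc (y : Y) (p : X × Y) :
    labelIndicator y p ∈ Set.Icc (0 : ℝ) 1 := by
  by_cases hp : p.2 = y <;> simp [labelIndicator, hp]

lemma sum_labelIndicator [Fintype Y] (p : X × Y) : ∑ y, labelIndicator y p = 1 := by
  classical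
  simp [labelIndicator, Set.indicator_apply]

lemma classCount_eq_sum [DecidableEq Y] {n : ℕ} (z : Fin n → X × Y) (y : Y) :
    (classCount z y : ℝ) = ∑ i, labelIndicator y (z i) := by
  simp [classCount, labelIndicator, Set.indicator_apply]

variable [MeasurableSpace X] [MeasurableSpace Y]

lemma measurableSet_label [MeasurableSingletonClass Y] (y : Y) :
    MeasurableSet {p : X × Y | p.2 = y} :=
  measurable_snd (measurableSet_singleton y)

lemma measurable_labelIndicator [MeasurableSingletonClass Y] (y : Y) :
    Measurable (labelIndicator (X := X) y) :=
  measurable_one.indicator (measurableSet_label y)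

lemma measurable_classCount [MeasurableSingletonClass Y] [DecidableEq Y] (n : ℕ) (y : Y) :
    Measurable fun z : Fin n → X × Y => (classCount z y : ℝ) := by
  simp_rw [classCount_eq_sum]
  exact Finset.measurable_fun_sum _ fun i _ =>
    (measurable_labelIndicator y).comp (measurable_pi_apply i)

lemma integral_abs_frequency_sub_le [MeasurableSingletonClass Y] [DecidableEq Y]
    (Q : Measure (X × Y)) [IsProbabilityMeasure Q] {n : ℕ} (hn : 0 < n) (y : Y) :
    ∫ z, |(classCount z y : ℝ) / n - labelMass Q y| ∂(Measure.pi fun _ : Fin n => Q) ≤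
      1 / √n := by
  have hne : (Finset.univ : Finset (Fin n)).Nonempty := ⟨⟨0, hn⟩, Finset.mem_univ _⟩
  have h := integral_abs_average_sub_le (fun _ : Fin n => Q) hne (measurable_labelIndicator y)
    (labelIndicator_mem_Icc y) (p := labelMass Q y)
    fun _ _ => integral_indicator_one (measurableSet_label y)
  simpa only [Finset.card_univ, Fintype.card_fin, ← classCount_eq_sum, one_div_mul_eq_div] using h

variable [Fintype Y] [DecidableEq Y] (Q : Measure (X × Y))

/-- The total deficit of the label frequencies in the sample `z`. -/
def labelDev {n : ℕ} (z : Fin n → X × Y) : ℝ :=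
  ∑ y, max 0 (labelMass Q y - classCount z y / n)

lemma abs_labelDev_le [IsProbabilityMeasure Q] {n : ℕ} (z : Fin n → X × Y) :
    |labelDev Q z| ≤ Fintype.card Y := by
  rw [abs_of_nonneg (Finset.sum_nonneg fun y _ => le_max_left _ _)]
  calc ∑ y, max 0 (labelMass Q y - classCount z y / n) ≤ ∑ _y : Y, (1 : ℝ) := by
        refine Finset.sum_le_sum fun y _ => max_le zero_le_one ?_
        have hmass : labelMass Q y ≤ 1 := measureReal_le_one
        have hfreq : (0 : ℝ) ≤ classCount z y / n := by positivity
        linarith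
    _ = Fintype.card Y := by simp

-- Only the frequency of the label of the replaced point can drop, and only by `1 / n`.
lemma labelDev_update_sub_le {n : ℕ} (i : Fin n) (z : Fin n → X × Y) (p : X × Y) :
    labelDev Q (Function.update z i p) - labelDev Q z ≤ (1 / n : ℝ≥0) := by
  have hdrop : ∀ y, max 0 (labelMass Q y - classCount (Function.update z i p) y / n) ≤
      max 0 (labelMass Q y - classCount z y / n) + labelIndicator y (z i) / n := fun y => by
    have hsum := sum_comp_update_sub (labelIndicator y) (Finset.mem_univ i) z p
    rw [← classCount_eq_sum, ← classCount_eq_sum] at hsum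
    have hcount : (classCount z y : ℝ) / n - classCount (Function.update z i p) y / n ≤
        labelIndicator y (z i) / n := by
      rw [← sub_div]
      gcongr
      linarith [(labelIndicator_mem_Icc y p).1]
    have hnonneg := div_nonneg (labelIndicator_mem_Icc y (z i)).1 n.cast_nonneg
    refine max_le (add_nonneg (le_max_left _ _) hnonneg) ?_
    linarith [le_max_right 0 (labelMass Q y - classCount z y / n)]
  rw [sub_le_iff_le_add', labelDev, labelDev]
  refine (Finset.sum_le_sum fun y _ => hdrop y).trans_eq ?_
  rw [Finset.sum_add_distrib, ← Finset.sum_div, sum_labelIndicator]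
  push_cast
  rfl

variable [MeasurableSingletonClass Y]

lemma measurable_labelDev (n : ℕ) : Measurable (labelDev (n := n) Q) :=
  Finset.measurable_fun_sum _ fun y _ =>
    measurable_const.max (((measurable_classCount n y).div_const _).const_sub _)

variable [IsProbabilityMeasure Q] {n : ℕ} (hn : 0 < n)

include hn

lemma integral_labelDev_le :
    ∫ z, labelDev Q z ∂(Measure.pi fun _ : Fin n => Q) ≤ Fintype.card Y * (1 / √n) := by
  have hint : ∀ y, Integrable (fun z : Fin n → X × Y =>
      |(classCount z y : ℝ) / n - labelMass Q y|) (Measure.pi fun _ : Fin n => Q) := fun y => by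
    have hmem := memLp_average (fun _ : Fin n => Q) (I := Finset.univ)
      (measurable_labelIndicator y) (labelIndicator_mem_Icc y)
    simp only [Finset.card_univ, Fintype.card_fin, ← classCount_eq_sum, one_div_mul_eq_div] at hmem
    exact ((hmem.integrable one_le_two).sub (integrable_const _)).abs
  calc _ ≤ ∫ z, ∑ y, |(classCount z y : ℝ) / n - labelMass Q y|
        ∂(Measure.pi fun _ : Fin n => Q) := by
        refine integral_mono (Integrable.of_bound (measurable_labelDev Q n).aestronglyMeasurable _
          (ae_of_all _ (abs_labelDev_le Q))) (integrable_finsetSum _ fun y _ => hint y) fun z => ?_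
        refine Finset.sum_le_sum fun y _ => max_le (abs_nonneg _) ?_
        rw [abs_sub_comm]
        exact le_abs_self _
    _ ≤ ∑ _y : Y, 1 / √(n : ℝ) := by
        rw [integral_finsetSum _ fun y _ => hint y]
        exact Finset.sum_le_sum fun y _ => integral_abs_frequency_sub_le Q hn y
    _ = Fintype.card Y * (1 / √n) := by simp

lemma measureReal_labelDev_gt_le {δ : ℝ} (hδ : 0 < δ) :
    (Measure.pi fun _ : Fin n => Q).real
      {z | Fintype.card Y * (1 / √n) + √(Real.log (1 / δ) / (2 * n)) < labelDev Q z} ≤ δ := by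
  have h := measureReal_gt_le_of_bounded_differences (fun _ : Fin n => Q)
    (measurable_labelDev Q n) (abs_labelDev_le Q) (fun _ => 1 / n)
    (labelDev_update_sub_le Q) (integral_labelDev_le Q hn) hδ
  have hvar : (∑ _i : Fin n, ((1 / n : ℝ≥0) : ℝ) ^ 2) / 2 * Real.log (1 / δ) =
      Real.log (1 / δ) / (2 * n) := by
    have : (0 : ℝ) < n := by exact_mod_cast hn
    push_cast
    simp only [Finset.sum_const, Finset.card_univ, Fintype.card_fin, nsmul_eq_mul]
    field_simp
  rwa [hvar] at h

end LabelFrequencies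

section Wasserstein

variable {X : Type*} [MetricSpace X]

lemma exists_lipschitzWith_one_eq_add_mul {K : ℝ≥0} {f : X → ℝ} (hf : LipschitzWith K f) :
    ∃ (c : ℝ) (g : X → ℝ), LipschitzWith 1 g ∧ f = fun x => c + K * g x := by
  rcases isEmpty_or_nonempty X with hX | ⟨⟨x₀⟩⟩
  · exact ⟨0, 0, LipschitzWith.const' 0, funext fun x => hX.elim x⟩
  have hdist : ∀ x y, |f x - f y| ≤ K * dist x y := fun x y => by
    simpa [Real.dist_eq] using hf.dist_le_mul x y
  rcases eq_or_ne K 0 with rfl | hK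
  · refine ⟨f x₀, 0, LipschitzWith.const' 0, funext fun x => ?_⟩
    have : |f x - f x₀| ≤ 0 := by simpa using hdist x x₀
    simpa using sub_eq_zero.1 (abs_nonpos_iff.1 this)
  · have hK0 : (0 : ℝ) < K := by positivity
    refine ⟨0, fun x => f x / K, LipschitzWith.of_dist_le_mul fun x y => ?_, funext fun x => ?_⟩
    · rw [Real.dist_eq, ← sub_div, abs_div, abs_of_pos hK0, div_le_iff₀ hK0, NNReal.coe_one,
        one_mul, mul_comm]
      exact hdist x y
    · field_simp
      simp

variable [MeasurableSpace X] {D : ℝ≥0} (hD : ∀ x y : X, dist x y ≤ D)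

include hD

lemma wasserstein1_le (μ ν : Measure X) [IsProbabilityMeasure μ] [IsProbabilityMeasure ν] :
    wasserstein1 μ ν ≤ D := by
  have hprod : ∫⁻ p, edist p.1 p.2 ∂(μ.prod ν) ≤ D := by
    calc _ ≤ ∫⁻ _, D ∂(μ.prod ν) := lintegral_mono fun p => by
          rw [edist_dist]
          exact ENNReal.ofReal_le_of_le_toReal (hD _ _)
      _ = D := by simp
  exact (iInf₂_le (μ.prod ν) ⟨by simp, by simp⟩).trans hprod

variable [SecondCountableTopology X] [BorelSpace X]

lemma integral_map_sub_integral_map_le (γ : Measure (X × X)) [IsProbabilityMeasure γ] {f : X → ℝ}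
    (hf : LipschitzWith 1 f) :
    (∫ x, f x ∂(γ.map Prod.fst)) - ∫ x, f x ∂(γ.map Prod.snd) ≤
      (∫⁻ p, edist p.1 p.2 ∂γ).toReal := by
  have := Measure.isProbabilityMeasure_map (μ := γ) measurable_fst.aemeasurable
  have := Measure.isProbabilityMeasure_map (μ := γ) measurable_snd.aemeasurable
  have hfst : Integrable (fun p : X × X => f p.1) γ :=
    (integrable_of_lipschitz (γ.map Prod.fst) hD hf).comp_measurable measurable_fst
  have hsnd : Integrable (fun p : X × X => f p.2) γ :=
    (integrable_of_lipschitz (γ.map Prod.snd) hD hf).comp_measurable measurable_snd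
  have hdm : AEStronglyMeasurable (fun p : X × X => dist p.1 p.2) γ :=
    continuous_dist.measurable.aestronglyMeasurable
  have hdist : Integrable (fun p : X × X => dist p.1 p.2) γ :=
    Integrable.of_bound hdm D (ae_of_all _ fun p => by simpa using hD p.1 p.2)
  have hfm := hf.continuous.measurable
  calc _ = ∫ p, (f p.1 - f p.2) ∂γ := by
        rw [integral_map measurable_fst.aemeasurable hfm.aestronglyMeasurable,
          integral_map measurable_snd.aemeasurable hfm.aestronglyMeasurable,
          integral_sub hfst hsnd]
    _ ≤ ∫ p, dist p.1 p.2 ∂γ := integral_mono (hfst.sub hsnd) hdist fun p =>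
        (le_abs_self _).trans (abs_sub_le_dist hf p.1 p.2)
    _ = _ := by
        rw [integral_eq_lintegral_of_nonneg_ae (ae_of_all _ fun p => dist_nonneg) hdm]
        simp_rw [edist_dist]

-- The easy half of Kantorovich duality.
lemma integral_sub_integral_le_wasserstein1 (μ ν : Measure X) [IsProbabilityMeasure μ]
    [IsProbabilityMeasure ν] {f : X → ℝ} (hf : LipschitzWith 1 f) :
    (∫ x, f x ∂μ) - ∫ x, f x ∂ν ≤ (wasserstein1 μ ν).toReal := by
  have hfin : wasserstein1 μ ν ≠ ⊤ := ((wasserstein1_le hD μ ν).trans_lt ENNReal.coe_lt_top).ne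
  rw [← ENNReal.ofReal_le_iff_le_toReal hfin]
  refine le_iInf₂ fun γ hγ => ENNReal.ofReal_le_of_le_toReal ?_
  have : IsProbabilityMeasure (γ.map Prod.fst) := hγ.1 ▸ inferInstance
  have : IsProbabilityMeasure γ := Measure.isProbabilityMeasure_of_map (f := Prod.fst)
  simpa only [hγ.1, hγ.2] using integral_map_sub_integral_map_le hD γ hf

end Wasserstein

section EmpiricalConditionals

variable {X Y : Type*} [MeasurableSpace X] [DecidableEq Y]

lemma isProbabilityMeasure_empCond {n : ℕ} {z : Fin n → X × Y} {y : Y} (h : 0 < classCount z y) :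
    IsProbabilityMeasure (empCond z y) := by
  constructor
  simp only [empCond, Measure.smul_apply, Measure.coe_finsetSum, Finset.sum_apply, measure_univ,
    Finset.sum_const, nsmul_eq_mul, mul_one, smul_eq_mul]
  exact ENNReal.inv_mul_cancel (by simpa using h.ne') (ENNReal.natCast_ne_top _)

lemma empW1_nonneg {X : Type*} [MetricSpace X] [MeasurableSpace X] {n m : ℕ}
    (zQ : Fin m → X × Y) (zS : Fin n → X × Y) (y : Y) : 0 ≤ empW1 zQ zS y :=
  ENNReal.toReal_nonneg

lemma integral_empCond [MeasurableSingletonClass X] {n : ℕ} (z : Fin n → X × Y) (y : Y)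
    (f : X → ℝ) : ∫ x, f x ∂(empCond z y) =
      (1 / ((classIdx z y).card : ℝ)) * ∑ i ∈ classIdx z y, f (z i).1 := by
  rw [empCond, integral_smul_measure, integral_finsetSum_measure fun i _ =>
    integrable_dirac (by simp)]
  simp [classCount, classIdx]

end EmpiricalConditionals

section ConditionalGap

variable {X Y : Type*} [MetricSpace X] [MeasurableSpace X] [DecidableEq Y]
  {D : ℝ≥0} (hD : ∀ x y : X, dist x y ≤ D) {n m : ℕ} {zQ : Fin m → X × Y}
  {zS : Fin n → X × Y} {y : Y} (hQ : 0 < classCount zQ y)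
  (hS : 0 < classCount zS y)

include hD hQ hS

lemma empW1_le : empW1 zQ zS y ≤ D := by
  have := isProbabilityMeasure_empCond hQ
  have := isProbabilityMeasure_empCond hS
  exact ENNReal.toReal_le_coe_of_le_coe (wasserstein1_le hD _ _)

variable [SecondCountableTopology X] [BorelSpace X] [MeasurableSpace Y]

-- Kantorovich duality compares the empirical conditional laws, `classDev` each of them to its true
-- one; as `classDev` is one-sided, it is applied to `-g` for `Q`.
lemma integral_condLaw_sub_le (Q S : Measure (X × Y)) [IsProbabilityMeasure (condLaw Q y)]
    [IsProbabilityMeasure (condLaw S y)] {K : ℝ≥0} {f : X → ℝ} (hf : LipschitzWith K f) :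
    (∫ x, f x ∂(condLaw Q y)) - ∫ x, f x ∂(condLaw S y) ≤
      K * (classDev Q zQ y + empW1 zQ zS y + classDev S zS y) := by
  have := isProbabilityMeasure_empCond hQ
  have := isProbabilityMeasure_empCond hS
  obtain ⟨c, g, hg, rfl⟩ := exists_lipschitzWith_one_eq_add_mul hf
  have hgap : (∫ x, c + K * g x ∂(condLaw Q y)) - ∫ x, c + K * g x ∂(condLaw S y) =
      K * ((∫ x, g x ∂(condLaw Q y)) - ∫ x, g x ∂(condLaw S y)) := by
    rw [integral_add (integrable_const _) ((integrable_of_lipschitz _ hD hg).const_mul _),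
      integral_add (integrable_const _) ((integrable_of_lipschitz _ hD hg).const_mul _)]
    simp only [integral_const, probReal_univ, integral_const_mul]
    ring
  have hdevQ := average_sub_integral_le_lipDev (condLaw Q y) hD (Finset.card_pos.1 hQ) hg.neg
    fun i => (zQ i).1
  have hdevS := average_sub_integral_le_lipDev (condLaw S y) hD (Finset.card_pos.1 hS) hg
    fun i => (zS i).1
  have hW := integral_sub_integral_le_wasserstein1 hD (empCond zQ y) (empCond zS y) hg
  rw [integral_empCond, integral_empCond] at hW
  simp only [Finset.sum_neg_distrib, integral_neg, Pi.neg_apply] at hdevQ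
  rw [hgap]
  refine mul_le_mul_of_nonneg_left ?_ K.2
  simp only [classDev, classIdx, empW1] at *
  linarith

end ConditionalGap

section WeightedDeviation

variable {τ ι Z : Type*} [Fintype τ]

lemma sqrt_sum_subgaussian_parameters {N : τ → ℕ} (hN : ∀ t, 0 < N t) (w : τ → ℝ) {B : ℝ}
    (hB : 0 ≤ B) (l : ℝ) :
    √(2 * (∑ t, w t ^ 2 * (B ^ 2 / (4 * N t))) * l) =
      B * √(∑ t, w t ^ 2 / ((N t : ℝ) / ∑ u, (N u : ℝ))) * √(l / (2 * ∑ u, (N u : ℝ))) := by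
  have hsum : 0 ≤ ∑ t, w t ^ 2 / ((N t : ℝ) / ∑ u, (N u : ℝ)) :=
    Finset.sum_nonneg fun t _ => by positivity
  conv_rhs => rw [← Real.sqrt_sq hB, ← Real.sqrt_mul (by positivity),
    ← Real.sqrt_mul (mul_nonneg (by positivity) hsum)]
  congr 1
  rw [Finset.mul_sum, Finset.sum_mul, Finset.mul_sum, Finset.sum_mul]
  refine Finset.sum_congr rfl fun t _ => ?_
  have hNt : (0 : ℝ) < N t := by exact_mod_cast hN t
  have htotal : 0 < ∑ u, (N u : ℝ) := Finset.sum_pos (fun u _ => by exact_mod_cast hN u)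
    ⟨t, Finset.mem_univ t⟩
  field_simp
  ring

variable [TopologicalSpace Z] [SecondCountableTopology Z] [MeasurableSpace Z] [BorelSpace Z]
  (S : τ → Measure Z) [∀ t, IsProbabilityMeasure (S t)] {g : τ → ι → Z → ℝ} {B : ℝ≥0}
  (hc : ∀ t h, Continuous (g t h)) (hg : ∀ t h p, 0 ≤ g t h p ∧ g t h p ≤ B) (N : τ → ℕ)

include hc hg

lemma hasSubgaussianMGF_sum_uniformDev (w : τ → ℝ) :
    HasSubgaussianMGF
      (fun z : ∀ t, Fin (N t) → Z => ∑ t, w t * (uniformDev (S t) (g t) (z t) -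
        ∫ z, uniformDev (S t) (g t) z ∂(Measure.pi fun _ : Fin (N t) => S t)))
      (∑ t, ⟨w t ^ 2, sq_nonneg _⟩ * (B ^ 2 / (4 * N t)))
      (Measure.pi fun t => Measure.pi fun _ : Fin (N t) => S t) := by
  let U : ∀ t, (Fin (N t) → Z) → ℝ := fun t z => w t * (uniformDev (S t) (g t) z -
    ∫ z, uniformDev (S t) (g t) z ∂(Measure.pi fun _ : Fin (N t) => S t))
  have hmeas : ∀ t, Measurable (U t) := fun t =>
    ((measurable_uniformDev (S t) (hc t) fun h p =>
      (abs_of_nonneg (hg t h p).1).trans_le (hg t h p).2).sub_const _).const_mul _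
  have hsub : ∀ t, HasSubgaussianMGF (fun z : ∀ t, Fin (N t) → Z => U t (z t))
      (⟨w t ^ 2, sq_nonneg _⟩ * (B ^ 2 / (4 * N t)))
      (Measure.pi fun t => Measure.pi fun _ : Fin (N t) => S t) := fun t => by
    have heval := measurePreserving_eval
      (fun t => Measure.pi fun _ : Fin (N t) => S t) t
    have h : HasSubgaussianMGF (U t) _ _ :=
      (hasSubgaussianMGF_uniformDev (S t) (hc t) (hg t) (n := N t)).const_mul (w t)
    rw [← heval.map_eq] at h
    exact HasSubgaussianMGF.of_map (Y := Function.eval t) heval.measurable.aemeasurable h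
  exact HasSubgaussianMGF.sum_of_iIndepFun
    (iIndepFun_pi fun t => (hmeas t).aemeasurable) (s := Finset.univ) fun t _ => hsub t

theorem measureReal_sum_uniformDev_gt_le (hN : ∀ t, 0 < N t) {w : τ → ℝ} (hw : ∀ t, 0 ≤ w t)
    {δ : ℝ} (hδ : 0 < δ) :
    (Measure.pi fun t => Measure.pi fun _ : Fin (N t) => S t).real
      {z | ∑ t, w t * (2 * radComplexity (S t) (g t) (N t)) +
        B * √(∑ t, w t ^ 2 / ((N t : ℝ) / ∑ u, (N u : ℝ))) *
          √(Real.log (1 / δ) / (2 * ∑ u, (N u : ℝ))) <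
        ∑ t, w t * uniformDev (S t) (g t) (z t)} ≤ δ := by
  have hmean : ∑ t, w t * ∫ z, uniformDev (S t) (g t) z ∂(Measure.pi fun _ : Fin (N t) => S t) ≤
      ∑ t, w t * (2 * radComplexity (S t) (g t) (N t)) :=
    Finset.sum_le_sum fun t _ => mul_le_mul_of_nonneg_left (integral_uniformDev_le (S t) (hc t)
      (fun h p => (abs_of_nonneg (hg t h p).1).trans_le (hg t h p).2) (hN t)) (hw t)
  have hradius := sqrt_sum_subgaussian_parameters hN w B.coe_nonneg (Real.log (1 / δ))
  refine (measureReal_mono fun z hz => ?_).trans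
    (measureReal_sqrt_lt_le_of_hasSubgaussianMGF (hasSubgaussianMGF_sum_uniformDev S hc hg N w) hδ)
  have hcoe : ((∑ t, ⟨w t ^ 2, sq_nonneg _⟩ * (B ^ 2 / (4 * N t)) : ℝ≥0) : ℝ) =
      ∑ t, w t ^ 2 * ((B : ℝ) ^ 2 / (4 * N t)) := by
    push_cast
    rfl
  rw [Set.mem_ofPred_eq] at hz ⊢
  simp only [mul_sub, Finset.sum_sub_distrib]
  rw [hcoe, hradius]
  linarith

end WeightedDeviation

section LabelDecomposition

variable {X Y : Type*} [MeasurableSpace X] [MeasurableSpace Y]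

lemma labelMass_nonneg (Q : Measure (X × Y)) (y : Y) : 0 ≤ labelMass Q y :=
  measureReal_nonneg

lemma measure_label_ne_zero {Q : Measure (X × Y)} {y : Y} (hy : labelMass Q y ≠ 0) :
    Q {p | p.2 = y} ≠ 0 := fun h => hy (by simp [labelMass, Measure.real, h])

variable [MeasurableSingletonClass Y]

lemma sum_labelMass [Fintype Y] (Q : Measure (X × Y)) [IsProbabilityMeasure Q] :
    ∑ y, labelMass Q y = 1 :=
  (sum_measureReal_preimage_singleton Finset.univ fun y _ => measurableSet_label y).trans
    (by simp)

lemma setIntegral_label (Q : Measure (X × Y)) [IsFiniteMeasure Q] {f : X × Y → ℝ}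
    (hf : Measurable f) (y : Y) :
    ∫ p in {p | p.2 = y}, f p ∂Q = labelMass Q y * ∫ x, f (x, y) ∂(condLaw Q y) := by
  have hlabel : ∫ p in {p | p.2 = y}, f p ∂Q = ∫ p in {p | p.2 = y}, f (p.1, y) ∂Q :=
    setIntegral_congr_fun (measurableSet_label y) fun p hp => by rw [← show p.2 = y from hp]
  have hfy : Measurable fun x => f (x, y) := by fun_prop
  rw [hlabel, condLaw, integral_map measurable_fst.aemeasurable hfy.aestronglyMeasurable,
    ProbabilityTheory.cond, integral_smul_measure, labelMass, Measure.real, smul_eq_mul,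
    ← mul_assoc, ENNReal.toReal_inv]
  rcases eq_or_ne (Q {p | p.2 = y}) 0 with h | h
  · simp [Measure.restrict_eq_zero.2 h]
  · rw [mul_inv_cancel₀ (ENNReal.toReal_ne_zero.2 ⟨h, measure_ne_top _ _⟩), one_mul]

lemma integral_eq_sum_labelMass_mul [Fintype Y] (Q : Measure (X × Y)) [IsFiniteMeasure Q]
    {f : X × Y → ℝ} (hf : Measurable f) (hint : Integrable f Q) :
    ∫ p, f p ∂Q = ∑ y, labelMass Q y * ∫ x, f (x, y) ∂(condLaw Q y) := by
  have hcover : ⋃ y, {p : X × Y | p.2 = y} = Set.univ := by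
    ext p
    simp
  rw [← setIntegral_univ, ← hcover, integral_iUnion_fintype measurableSet_label
    (fun a b hab => Set.disjoint_left.2 fun p (ha : p.2 = a) (hb : p.2 = b) =>
      hab (ha.symm.trans hb)) fun y => hint.integrableOn]
  exact Finset.sum_congr rfl fun y _ => setIntegral_label Q hf y

-- Reweighting by `labelRatio` gives the source the label law of the target.
lemma integral_sub_integral_labelRatio_mul [Fintype Y] {S Q : Measure (X × Y)}
    [IsFiniteMeasure S] [IsFiniteMeasure Q]
    (hSQ : ∀ y, labelMass S y = 0 → labelMass Q y = 0) {f : X × Y → ℝ} (hf : Measurable f)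
    (hfS : Integrable f S) (hfQ : Integrable f Q) :
    (∫ p, f p ∂Q) - ∫ p, labelRatio S Q p.2 * f p ∂S =
      ∑ y, labelMass Q y *
        ((∫ x, f (x, y) ∂(condLaw Q y)) - ∫ x, f (x, y) ∂(condLaw S y)) := by
  have hratio : Measurable fun p : X × Y => labelRatio S Q p.2 :=
    (measurable_of_finite (labelRatio S Q)).comp measurable_snd
  obtain ⟨b, hb⟩ := Finite.exists_le fun y => |labelRatio S Q y|
  have hint : Integrable (fun p => labelRatio S Q p.2 * f p) S :=
    hfS.bdd_mul hratio.aestronglyMeasurable (ae_of_all _ fun p => hb p.2)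
  have hS := integral_eq_sum_labelMass_mul S (f := fun p => labelRatio S Q p.2 * f p)
    (hratio.mul hf) hint
  rw [integral_eq_sum_labelMass_mul Q hf hfQ, hS, ← Finset.sum_sub_distrib]
  refine Finset.sum_congr rfl fun y _ => ?_
  have hmass : labelMass S y * labelRatio S Q y = labelMass Q y := by
    rcases eq_or_ne (labelMass S y) 0 with h | h
    · rw [h, zero_mul, hSQ y h]
    · exact mul_div_cancel₀ _ h
  simp only [integral_const_mul]
  rw [← mul_assoc, hmass, mul_sub]

end LabelDecomposition

section SourceTargetGap

variable {X Y : Type*} [MetricSpace X] [SecondCountableTopology X] [MeasurableSpace X]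
  [BorelSpace X] [MeasurableSpace Y] [MeasurableSingletonClass Y] [Fintype Y] [DecidableEq Y]

theorem integral_sub_integral_labelRatio_mul_le {D : ℝ≥0} (hD : ∀ x y : X, dist x y ≤ D)
    {S Q : Measure (X × Y)} [IsProbabilityMeasure S] [IsProbabilityMeasure Q]
    (hSQ : ∀ y, labelMass S y = 0 → labelMass Q y = 0) {K : ℝ≥0} {f : X × Y → ℝ}
    (hf : ∀ y, LipschitzWith K fun x => f (x, y)) (hfm : Measurable f) (hfS : Integrable f S)
    (hfQ : Integrable f Q) {n m : ℕ} {zQ : Fin m → X × Y} {zS : Fin n → X × Y}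
    (hpos : ∀ y, 0 < labelMass Q y → 0 < classCount zQ y ∧ 0 < classCount zS y) {r w : ℝ}
    (hw0 : 0 ≤ w) (hw : ∀ y, 0 < labelMass Q y → empW1 zQ zS y ≤ w)
    (hr : ∀ y, 0 < labelMass Q y → classDev S zS y + classDev Q zQ y ≤ r) :
    (∫ p, f p ∂Q) - ∫ p, labelRatio S Q p.2 * f p ∂S ≤
      K * (∑ y, ((classCount zQ y : ℝ) / m) * empW1 zQ zS y) + K * (r + w * labelDev Q zQ) := by
  have hlabel : ∀ y, labelMass Q y *
      ((∫ x, f (x, y) ∂(condLaw Q y)) - ∫ x, f (x, y) ∂(condLaw S y)) ≤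
      K * ((classCount zQ y : ℝ) / m * empW1 zQ zS y + labelMass Q y * r +
        w * max 0 (labelMass Q y - classCount zQ y / m)) := fun y => by
    have hW0 := empW1_nonneg zQ zS y
    rcases (labelMass_nonneg Q y).eq_or_lt with h | hy
    · rw [← h]
      simp only [zero_mul, add_zero]
      positivity
    have := isProbabilityMeasure_condLaw Q (measure_label_ne_zero hy.ne')
    have := isProbabilityMeasure_condLaw S (measure_label_ne_zero fun h => hy.ne' (hSQ y h))
    have hcond := integral_condLaw_sub_le hD (hpos y hy).1 (hpos y hy).2 Q S (hf y)
    have hfreq : (labelMass Q y - classCount zQ y / m) * empW1 zQ zS y ≤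
        max 0 (labelMass Q y - classCount zQ y / m) * w :=
      mul_le_mul (le_max_right _ _) (hw y hy) hW0 (le_max_left _ _)
    calc _ ≤ labelMass Q y * (K * (empW1 zQ zS y + r)) := by
          gcongr
          refine hcond.trans (mul_le_mul_of_nonneg_left ?_ K.coe_nonneg)
          linarith [hr y hy]
      _ = K * (labelMass Q y * empW1 zQ zS y + labelMass Q y * r) := by ring
      _ ≤ _ := mul_le_mul_of_nonneg_left (by linarith) K.coe_nonneg
  rw [integral_sub_integral_labelRatio_mul hSQ hfm hfS hfQ]
  refine (Finset.sum_le_sum fun y _ => hlabel y).trans_eq ?_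
  rw [← Finset.mul_sum, Finset.sum_add_distrib, Finset.sum_add_distrib, ← Finset.sum_mul,
    sum_labelMass, ← Finset.mul_sum, labelDev]
  ring

end SourceTargetGap

section Comp

lemma classRadius_antitoneOn {C s D : ℝ} (hC : 0 ≤ C) (hs : 0 ≤ s) (hD : 0 ≤ D) (δ : ℝ) :
    AntitoneOn (classRadius C s D δ) (Set.Ioi 0) := fun k hk k' _ hkk' => by
  have hk0 : (0 : ℝ) < k := by exact_mod_cast hk
  have hle : (k : ℝ) ≤ k' := by exact_mod_cast hkk'
  have hrpow : (k' : ℝ) ^ (-(1 / s)) ≤ (k : ℝ) ^ (-(1 / s)) :=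
    Real.rpow_le_rpow_of_nonpos hk0 hle (by simpa using hs)
  unfold classRadius
  gcongr

lemma kappa_eq_classRadius_add (C s D : ℝ) (T c : ℕ) (δ : ℝ) (k m : ℕ) :
    kappa C s D T c δ k m =
      classRadius C s D (δ / (2 * T * c)) k + classRadius C s D (δ / (2 * T * c)) m := by
  rw [kappa, classRadius, classRadius, one_div_div]
  ring

lemma one_div_sqrt_le_rpow {s : ℝ} (hs : 2 ≤ s) {m M : ℕ} (hm : 0 < m) (hmM : m ≤ M) :
    1 / √(M : ℝ) ≤ (m : ℝ) ^ (-(1 / s)) := by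
  have hm0 : (0 : ℝ) < m := by exact_mod_cast hm
  have hM1 : (1 : ℝ) ≤ M := by exact_mod_cast hm.trans_le hmM
  calc 1 / √(M : ℝ) = (M : ℝ) ^ (-(1 / 2 : ℝ)) := by
        rw [Real.sqrt_eq_rpow, Real.rpow_neg (by linarith), one_div]
    _ ≤ (M : ℝ) ^ (-(1 / s)) := Real.rpow_le_rpow_of_exponent_le hM1 <| neg_le_neg <| by gcongr
    _ ≤ (m : ℝ) ^ (-(1 / s)) := Real.rpow_le_rpow_of_nonpos hm0 (by exact_mod_cast hmM) <|
        neg_nonpos.2 (by positivity)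

-- Enlarging the constant in `kappa` absorbs the mean deviation of the label frequencies.
lemma kappa_add_le {C s D w : ℝ} (hs : 2 ≤ s) (hD : 0 ≤ D) (hw : w ≤ D) (T c : ℕ) (δ : ℝ)
    {k m M : ℕ} (hm : 0 < m) (hmM : m ≤ M) :
    kappa C s D T c δ k m + w * (c * (1 / √M)) ≤ kappa (C + D * c + 1) s D T c δ k m := by
  have hfreq : w * (c * (1 / √(M : ℝ))) ≤ D * (c * (m : ℝ) ^ (-(1 / s))) := by
    have := one_div_sqrt_le_rpow hs hm hmM
    gcongr
  have hk0 : (0 : ℝ) ≤ (D * c + 1) * (k : ℝ) ^ (-(1 / s)) := by positivity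
  have hm0 : (0 : ℝ) ≤ (m : ℝ) ^ (-(1 / s)) := by positivity
  unfold kappa
  linarith

variable {X Y : Type*} [MeasurableSpace X] [MeasurableSpace Y] [Fintype Y] {T : ℕ}

lemma comp_le_comp {S : Fin T → Measure (X × Y)} {Q : Measure (X × Y)} {ℓ : ℝ → ℝ}
    {H : Set (X → Y → ℝ)} {LK C s D w δ : ℝ} (hLK : 0 ≤ LK) (hC : 0 ≤ C) (hs : 0 ≤ s)
    (hD : 0 ≤ D) (hw : 0 ≤ w) {N N' : Fin T → ℕ} {M M' : ℕ} {k k' : Fin T → Y → ℕ} {m m' : Y → ℕ}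
    (hrad : ∀ t, rademacher (S t) (labelRatio (S t) Q) ℓ H (N' t) ≤
      rademacher (S t) (labelRatio (S t) Q) ℓ H (N t))
    (hM : 0 < M) (hpos : ∀ y, 0 < labelMass Q y → 0 < m y ∧ ∀ t, 0 < k t y)
    (hMM' : M ≤ M') (hk : k ≤ k') (hm : m ≤ m') :
    comp S Q ℓ H LK C s D w N' M' k' m' δ ≤ comp S Q ℓ H LK C s D w N M k m δ := by
  have : (0 : ℝ) < M := by exact_mod_cast hM
  have hMM'0 : (M : ℝ) ≤ M' := by exact_mod_cast hMM'
  have hsqrt : ∀ a : ℝ, √(a / M') ≤ √(a / M) := fun a => by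
    rcases le_total 0 a with ha | ha
    · gcongr
    · rw [Real.sqrt_eq_zero_of_nonpos (div_nonpos_of_nonpos_of_nonneg ha (Nat.cast_nonneg _))]
      positivity
  have hkappa : ∀ p : Fin T × {y : Y // 0 < labelMass Q y},
      kappa C s D T (Fintype.card Y) δ (k' p.1 p.2) (m' p.2) ≤
        kappa C s D T (Fintype.card Y) δ (k p.1 p.2) (m p.2) := fun p => by
    obtain ⟨hm0, hk0⟩ := hpos _ p.2.2
    have hanti := classRadius_antitoneOn hC hs hD (δ / (2 * T * Fintype.card Y))
    rw [kappa_eq_classRadius_add, kappa_eq_classRadius_add]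
    exact add_le_add (hanti (hk0 p.1) ((hk0 p.1).trans_le (hk _ _)) (hk _ _))
      (hanti hm0 (hm0.trans_le (hm _)) (hm _))
  have hlog := add_le_add (hsqrt (2 * Real.log (2 * Fintype.card Y))) (hsqrt (Real.log (T / δ) / 2))
  simp only [comp, ← div_div]
  exact add_le_add (mul_le_mul_of_nonneg_left (ciSup_mono (Set.finite_range _).bddAbove hrad)
    zero_le_two) (mul_le_mul_of_nonneg_left (add_le_add
      (ciSup_mono (Set.finite_range _).bddAbove hkappa) (mul_le_mul_of_nonneg_left hlog hw)) hLK)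

end Comp

section WeightedLoss

variable {X Y : Type*}

/-- The class of reweighted losses `(x, y) ↦ a y * ℓ (h x y)`, indexed by the hypotheses `h ∈ H`;
its `radComplexity` is `rademacher` by definition. -/
def weightedLoss (a : Y → ℝ) (ℓ : ℝ → ℝ) (H : Set (X → Y → ℝ)) (h : H) (p : X × Y) : ℝ :=
  a p.2 * ℓ (h.1 p.1 p.2)

lemma continuous_weightedLoss [TopologicalSpace X] [TopologicalSpace Y] [DiscreteTopology Y]
    (a : Y → ℝ) {ℓ : ℝ → ℝ} (hℓ : Continuous ℓ) {H : Set (X → Y → ℝ)}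
    (hH : ∀ h ∈ H, ∀ y, Continuous fun x => h x y) (h : H) : Continuous (weightedLoss a ℓ H h) :=
  (continuous_of_discreteTopology.comp continuous_snd).mul
    (hℓ.comp (continuous_prod_of_discrete_right.2 (hH h.1 h.2)))

lemma weightedLoss_bounds {a : Y → ℝ} {A : ℝ} (ha : ∀ y, 0 ≤ a y ∧ a y ≤ A) {ℓ : ℝ → ℝ}
    {Lmax : ℝ} (hℓ : ∀ u, 0 ≤ ℓ u ∧ ℓ u ≤ Lmax) (H : Set (X → Y → ℝ)) (h : H) (p : X × Y) :
    0 ≤ weightedLoss a ℓ H h p ∧ weightedLoss a ℓ H h p ≤ Lmax * A := by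
  obtain ⟨ha0, haA⟩ := ha p.2
  obtain ⟨hℓ0, hℓL⟩ := hℓ (h.1 p.1 p.2)
  refine ⟨mul_nonneg ha0 hℓ0, ?_⟩
  rw [mul_comm Lmax]
  exact mul_le_mul haA hℓL hℓ0 (ha0.trans haA)

lemma empRisk_le_add [Fintype Y] {n : ℕ} (z : Fin n → X × Y) (a b : Y → ℝ)
    {ℓ : ℝ → ℝ} {Lmax : ℝ} (hℓ : ∀ u, 0 ≤ ℓ u ∧ ℓ u ≤ Lmax) (h : X → Y → ℝ) :
    empRisk z a ℓ h ≤ empRisk z b ℓ h + Lmax * √(∑ y, (a y - b y) ^ 2) := by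
  set r := Lmax * √(∑ y, (a y - b y) ^ 2)
  have hr : 0 ≤ r := mul_nonneg ((hℓ 0).1.trans (hℓ 0).2) (Real.sqrt_nonneg _)
  have hcoord : ∀ y, a y - b y ≤ √(∑ y, (a y - b y) ^ 2) := fun y =>
    Real.le_sqrt_of_sq_le (Finset.single_le_sum (f := fun y => (a y - b y) ^ 2)
      (fun _ _ => sq_nonneg _) (Finset.mem_univ y))
  have hterm : ∀ i, a (z i).2 * ℓ (h (z i).1 (z i).2) ≤
      b (z i).2 * ℓ (h (z i).1 (z i).2) + r := fun i => by
    obtain ⟨hℓ0, hℓL⟩ := hℓ (h (z i).1 (z i).2)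
    have hdiff : (a (z i).2 - b (z i).2) * ℓ (h (z i).1 (z i).2) ≤ r :=
      (mul_le_mul (hcoord _) hℓL hℓ0 (Real.sqrt_nonneg _)).trans_eq (mul_comm _ _)
    linarith
  have hmean : (1 / (n : ℝ)) * (n * r) ≤ r := by
    rcases n.eq_zero_or_pos with rfl | hn
    · simpa using hr
    · field_simp
      exact le_rfl
  calc empRisk z a ℓ h
      ≤ (1 / (n : ℝ)) * ∑ i, (b (z i).2 * ℓ (h (z i).1 (z i).2) + r) :=
        mul_le_mul_of_nonneg_left (Finset.sum_le_sum fun i _ => hterm i) (by positivity)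
    _ = empRisk z b ℓ h + (1 / (n : ℝ)) * (n * r) := by
        simp [empRisk, Finset.sum_add_distrib, mul_add]
    _ ≤ _ := by gcongr

end WeightedLoss

section LabelRatio

variable {X Y : Type*} [MeasurableSpace X] [MeasurableSpace Y]

lemma labelRatio_bounds [Finite Y] {T : ℕ} (S : Fin T → Measure (X × Y)) (Q : Measure (X × Y))
    (t : Fin T) (y : Y) : 0 ≤ labelRatio (S t) Q y ∧
      labelRatio (S t) Q y ≤ ⨆ p : Fin T × Y, labelRatio (S p.1) Q p.2 :=
  ⟨div_nonneg (labelMass_nonneg Q y) (labelMass_nonneg (S t) y),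
    le_ciSup (f := fun p : Fin T × Y => labelRatio (S p.1) Q p.2)
      (Set.finite_range _).bddAbove (t, y)⟩

end LabelRatio

section ReweightedLosses

variable {X Y : Type*} [TopologicalSpace X] [SecondCountableTopology X] [MeasurableSpace X]
  [BorelSpace X] [MeasurableSpace Y] [MeasurableSingletonClass Y] [Finite Y]
  {ℓ : ℝ → ℝ} (hℓc : Continuous ℓ)
  {Lmax : ℝ} (hℓ : ∀ u, 0 ≤ ℓ u ∧ ℓ u ≤ Lmax) {H : Set (X → Y → ℝ)}
  (hH : ∀ h ∈ H, ∀ y, Continuous fun x => h x y)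

include hℓc hℓ hH

lemma rademacher_antitoneOn (S : Measure (X × Y)) [IsProbabilityMeasure S] {a : Y → ℝ}
    {A : ℝ} (ha : ∀ y, 0 ≤ a y ∧ a y ≤ A) : AntitoneOn (rademacher S a ℓ H) (Set.Ioi 0) := by
  let _ : TopologicalSpace Y := ⊥
  have : DiscreteTopology Y := ⟨rfl⟩
  have hbound : ∀ h p, |weightedLoss a ℓ H h p| ≤ (Lmax * A).toNNReal := fun h p => by
    obtain ⟨h0, hle⟩ := weightedLoss_bounds ha hℓ H h p
    rw [abs_of_nonneg h0]
    exact hle.trans (Real.le_coe_toNNReal _)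
  intro n hn m hm hnm
  exact radComplexity_antitoneOn S (continuous_weightedLoss a hℓc hH) hbound hn hm hnm

lemma measureReal_sum_uniformDev_weightedLoss_gt_le {T : ℕ}
    (S : Fin T → Measure (X × Y)) [∀ t, IsProbabilityMeasure (S t)] (Q : Measure (X × Y))
    {N : Fin T → ℕ} (hN : ∀ t, 0 < N t) {w : Fin T → ℝ} (hw : ∀ t, 0 ≤ w t) {δ : ℝ} (hδ : 0 < δ) :
    (Measure.pi fun t => Measure.pi fun _ : Fin (N t) => S t).real
      {z | ∑ t, w t * (2 * rademacher (S t) (labelRatio (S t) Q) ℓ H (N t)) +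
        Lmax * (⨆ p : Fin T × Y, labelRatio (S p.1) Q p.2) *
          √(∑ t, w t ^ 2 / ((N t : ℝ) / ∑ u, (N u : ℝ))) *
          √(Real.log (1 / δ) / (2 * ∑ u, (N u : ℝ))) <
        ∑ t, w t * uniformDev (S t) (weightedLoss (labelRatio (S t) Q) ℓ H) (z t)} ≤ δ := by
  let _ : TopologicalSpace Y := ⊥
  have : DiscreteTopology Y := ⟨rfl⟩
  have hB : 0 ≤ Lmax * ⨆ p : Fin T × Y, labelRatio (S p.1) Q p.2 :=
    mul_nonneg ((hℓ 0).1.trans (hℓ 0).2)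
      (Real.iSup_nonneg fun p => (labelRatio_bounds S Q p.1 p.2).1)
  exact measureReal_sum_uniformDev_gt_le S (B := ⟨_, hB⟩)
    (fun t => continuous_weightedLoss (labelRatio (S t) Q) hℓc hH)
    (fun t => weightedLoss_bounds (labelRatio_bounds S Q t) hℓ H) N hN hw hδ

end ReweightedLosses

section UnionBounds

lemma measureReal_exists_le {Ω ι : Type*} [MeasurableSpace Ω] [Fintype ι] (P : Measure Ω)
    {p : ι → Ω → Prop} {ε : ℝ} (h : ∀ i, P.real {ω | p i ω} ≤ ε) :
    P.real {ω | ∃ i, p i ω} ≤ Fintype.card ι * ε := by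
  rw [Set.ofPred_exists]
  calc _ ≤ ∑ i, P.real {ω | p i ω} := measureReal_iUnion_fintype_le _
    _ ≤ ∑ _i : ι, ε := Finset.sum_le_sum fun i _ => h i
    _ = _ := by simp

lemma exists_measurableSet_of_measureReal_le {Ω : Type*} [MeasurableSpace Ω] (P : Measure Ω)
    [IsProbabilityMeasure P] {p : Ω → Prop} {ε : ℝ} (h : P.real {ω | ¬ p ω} ≤ ε) :
    ∃ E, MeasurableSet E ∧ 1 - ε ≤ P.real E ∧ ∀ ω ∈ E, p ω := by
  have hm := measurableSet_toMeasurable P {ω | ¬ p ω}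
  refine ⟨(toMeasurable P {ω | ¬ p ω})ᶜ, hm.compl, ?_, fun ω hω => ?_⟩
  · rw [probReal_compl_eq_one_sub hm, Measure.real, measure_toMeasurable]
    exact sub_le_sub_left h 1
  · by_contra hp
    exact hω (subset_toMeasurable P _ hp)

lemma measureReal_preimage_le {Ω Ω' : Type*} [MeasurableSpace Ω] [MeasurableSpace Ω']
    {P : Measure Ω} {P' : Measure Ω'} [IsFiniteMeasure P'] {f : Ω → Ω'}
    (hf : MeasurePreserving f P P') (A : Set Ω') : P.real (f ⁻¹' A) ≤ P'.real A :=
  ENNReal.toReal_mono (measure_ne_top _ _) (hf.measure_preimage_le A)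

end UnionBounds

section TypicalData

variable {X Y : Type*} [MeasurableSpace X] [MeasurableSpace Y] {T : ℕ}

section DataLaw

variable (S : Fin T → Measure (X × Y)) (Q : Measure (X × Y)) [IsProbabilityMeasure Q]
  (N : Fin T → ℕ) (M : ℕ)

instance isProbabilityMeasure_dataLaw [∀ t, IsProbabilityMeasure (S t)] :
    IsProbabilityMeasure (dataLaw S Q N M) := by
  unfold dataLaw
  infer_instance

lemma measurePreserving_sources : MeasurePreserving Prod.fst (dataLaw S Q N M)
    (Measure.pi fun t => Measure.pi fun _ : Fin (N t) => S t) :=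
  measurePreserving_fst

lemma measurePreserving_source [∀ t, IsProbabilityMeasure (S t)] (t : Fin T) :
    MeasurePreserving (fun z => z.1 t) (dataLaw S Q N M) (Measure.pi fun _ : Fin (N t) => S t) :=
  (measurePreserving_eval (fun t => Measure.pi fun _ : Fin (N t) => S t) t).comp
    (measurePreserving_sources S Q N M)

lemma measurePreserving_target [∀ t, IsProbabilityMeasure (S t)] :
    MeasurePreserving Prod.snd (dataLaw S Q N M) (Measure.pi fun _ : Fin M => Q) :=
  measurePreserving_snd

end DataLaw

variable [MetricSpace X] [Fintype Y] [DecidableEq Y]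

/-- The samples `z` are typical, for source weights `w`: the weighted uniform deviations of the
reweighted source risks, the class conditionals and the target label frequencies are all as close
to their population values as confidence `δ` allows. Each of the `(T + 1) * card Y` class
conditionals gets confidence `δ / (2 * T * card Y)`, as in `kappa`. -/
structure IsTypical (S : Fin T → Measure (X × Y)) (Q : Measure (X × Y)) (ℓ : ℝ → ℝ)
    (H : Set (X → Y → ℝ)) (Lmax C s D δ : ℝ) (w : Fin T → ℝ) {N : Fin T → ℕ} {M : ℕ}
    (z : (∀ t, Fin (N t) → X × Y) × (Fin M → X × Y)) : Prop where
  sum_uniformDev_le : ∑ t, w t * uniformDev (S t) (weightedLoss (labelRatio (S t) Q) ℓ H) (z.1 t) ≤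
    ∑ t, w t * (2 * rademacher (S t) (labelRatio (S t) Q) ℓ H (N t)) +
      Lmax * (⨆ p : Fin T × Y, labelRatio (S p.1) Q p.2) *
        √(∑ t, w t ^ 2 / ((N t : ℝ) / ∑ u, (N u : ℝ))) *
        √(Real.log (1 / δ) / (2 * ∑ u, (N u : ℝ)))
  source_classDev_le : ∀ t y, 0 < classCount (z.1 t) y → classDev (S t) (z.1 t) y ≤
    classRadius C s D (δ / (2 * T * Fintype.card Y)) (classCount (z.1 t) y)
  target_classDev_le : ∀ y, 0 < classCount z.2 y → classDev Q z.2 y ≤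
    classRadius C s D (δ / (2 * T * Fintype.card Y)) (classCount z.2 y)
  labelDev_le : labelDev Q z.2 ≤ Fintype.card Y * (1 / √M) + √(Real.log (1 / δ) / (2 * M))

variable [SecondCountableTopology X] [MeasurableSingletonClass Y]
  (S : Fin T → Measure (X × Y)) (Q : Measure (X × Y)) [∀ t, IsProbabilityMeasure (S t)]
  [IsProbabilityMeasure Q] {D : ℝ≥0} (hD : ∀ x y : X, dist x y ≤ D) {C s : ℝ}
  (hrate : HasLipDevRate X C s) {N : Fin T → ℕ} {M : ℕ} {δ : ℝ} (hδ : 0 < δ)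

include hD hrate hδ

lemma measureReal_exists_source_classDev_gt_le [OpensMeasurableSpace X] [Nonempty Y] (hT : 0 < T) :
    (dataLaw S Q N M).real {z | ∃ p : Fin T × Y, 0 < classCount (z.1 p.1) p.2 ∧
      classRadius C s D (δ / (2 * T * Fintype.card Y)) (classCount (z.1 p.1) p.2) <
        classDev (S p.1) (z.1 p.1) p.2} ≤ δ / 2 := by
  have : 0 < Fintype.card Y := Fintype.card_pos
  refine (measureReal_exists_le _ fun p : Fin T × Y =>
    (measureReal_preimage_le (measurePreserving_source S Q N M p.1) _).trans
      (measureReal_classDev_gt_le hD hrate (S p.1) (by positivity))).trans_eq ?_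
  rw [Fintype.card_prod, Fintype.card_fin, Nat.cast_mul]
  field_simp

lemma measureReal_exists_target_classDev_gt_le [OpensMeasurableSpace X] [Nonempty Y] (hT : 0 < T) :
    (dataLaw S Q N M).real {z | ∃ y, 0 < classCount z.2 y ∧
      classRadius C s D (δ / (2 * T * Fintype.card Y)) (classCount z.2 y) < classDev Q z.2 y} ≤
      δ / 2 := by
  have : 0 < Fintype.card Y := Fintype.card_pos
  have hT1 : (1 : ℝ) ≤ T := by exact_mod_cast hT
  refine (measureReal_exists_le _ fun y =>
    (measureReal_preimage_le (measurePreserving_target S Q N M) _).trans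
      (measureReal_classDev_gt_le hD hrate Q (by positivity))).trans ?_
  calc (Fintype.card Y : ℝ) * (δ / (2 * T * Fintype.card Y)) = δ / 2 / T := by field_simp
    _ ≤ δ / 2 := div_le_self (by positivity) hT1

theorem measureReal_not_isTypical_le [BorelSpace X] (hT : 0 < T) (hN : ∀ t, 0 < N t) (hM : 0 < M)
    {ℓ : ℝ → ℝ} (hℓc : Continuous ℓ) {Lmax : ℝ} (hℓ : ∀ u, 0 ≤ ℓ u ∧ ℓ u ≤ Lmax)
    {H : Set (X → Y → ℝ)} (hH : ∀ h ∈ H, ∀ y, Continuous fun x => h x y) {w : Fin T → ℝ}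
    (hw : ∀ t, 0 ≤ w t) :
    (dataLaw S Q N M).real {z | ¬ IsTypical S Q ℓ H Lmax C s D δ w z} ≤ 3 * δ := by
  have hXY : Nonempty (X × Y) := nonempty_of_isProbabilityMeasure Q
  have : Nonempty Y := hXY.map Prod.snd
  have hrisk := (measureReal_preimage_le (measurePreserving_sources S Q N M) _).trans
    (measureReal_sum_uniformDev_weightedLoss_gt_le hℓc hℓ hH S Q hN hw hδ)
  have hsource := measureReal_exists_source_classDev_gt_le S Q hD hrate (N := N) (M := M) hδ hT
  have htarget := measureReal_exists_target_classDev_gt_le S Q hD hrate (N := N) (M := M) hδ hT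
  have hlabel := (measureReal_preimage_le (measurePreserving_target S Q N M) _).trans
    (measureReal_labelDev_gt_le Q hM hδ)
  refine (measureReal_mono (fun z hz => ?_) (measure_ne_top _ _)).trans <|
    (measureReal_union_le _ _).trans <| (add_le_add ((measureReal_union_le _ _).trans <|
      add_le_add ((measureReal_union_le _ _).trans (add_le_add hrisk hsource)) htarget)
        hlabel).trans (by linarith)
  contrapose! hz
  simp only [Set.mem_union, Set.mem_preimage, Set.mem_ofPred_eq, not_or, not_exists, not_and,
    not_lt, not_not] at hz ⊢
  obtain ⟨⟨⟨h₁, h₂⟩, h₃⟩, h₄⟩ := hz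
  exact ⟨h₁, fun t y => h₂ (t, y), h₃, h₄⟩

end TypicalData

section SimplexAverage

variable {ι : Type*} [Fintype ι] {w : ι → ℝ} (hw : w ∈ stdSimplex ℝ ι)

include hw

lemma nonempty_of_mem_stdSimplex : Nonempty ι := by
  by_contra h
  rw [not_nonempty_iff] at h
  simpa using hw.2

lemma le_sum_mul_of_forall_le {a : ℝ} {r : ι → ℝ} (h : ∀ i, a ≤ r i) : a ≤ ∑ i, w i * r i :=
  calc a = ∑ i, w i * a := by rw [← Finset.sum_mul, hw.2, one_mul]
    _ ≤ _ := Finset.sum_le_sum fun i _ => mul_le_mul_of_nonneg_left (h i) (hw.1 i)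

lemma sum_mul_le_iSup (r : ι → ℝ) : ∑ i, w i * r i ≤ ⨆ i, r i :=
  calc ∑ i, w i * r i ≤ ∑ i, w i * ⨆ i, r i := Finset.sum_le_sum fun i _ =>
        mul_le_mul_of_nonneg_left (le_ciSup (Set.finite_range r).bddAbove i) (hw.1 i)
    _ = _ := by rw [← Finset.sum_mul, hw.2, one_mul]

end SimplexAverage

section MaxEmpW1

variable {X Y : Type*} [MetricSpace X] [MeasurableSpace X] [MeasurableSpace Y] [DecidableEq Y]
  {T : ℕ} {N : Fin T → ℕ} {M : ℕ} (Q : Measure (X × Y)) (zS : ∀ t, Fin (N t) → X × Y)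
  (zQ : Fin M → X × Y)

lemma maxEmpW1_nonneg : 0 ≤ maxEmpW1 Q zS zQ :=
  Real.iSup_nonneg fun p => empW1_nonneg zQ (zS p.1) p.2

lemma maxEmpW1_le {D : ℝ≥0} (hD : ∀ x y : X, dist x y ≤ D)
    (hpos : ∀ y, 0 < labelMass Q y → 0 < classCount zQ y ∧ ∀ t, 0 < classCount (zS t) y) :
    maxEmpW1 Q zS zQ ≤ D :=
  Real.iSup_le (fun p => empW1_le hD (hpos _ p.2.2).1 ((hpos _ p.2.2).2 p.1)) D.coe_nonneg

lemma empW1_le_maxEmpW1 [Finite Y] (t : Fin T) {y : Y} (hy : 0 < labelMass Q y) :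
    empW1 zQ (zS t) y ≤ maxEmpW1 Q zS zQ :=
  le_ciSup (f := fun p : Fin T × {y : Y // 0 < labelMass Q y} => empW1 zQ (zS p.1) p.2)
    (Set.finite_range _).bddAbove (t, ⟨y, hy⟩)

end MaxEmpW1

section RiskBound

variable {X Y : Type*} [MeasurableSpace X] [MeasurableSpace Y] [Fintype Y]
  {T : ℕ} {ℓ : ℝ → ℝ} {Lmax : ℝ} (hℓ : ∀ u, 0 ≤ ℓ u ∧ ℓ u ≤ Lmax) {H : Set (X → Y → ℝ)}

include hℓ

lemma integral_labelRatio_mul_loss_le (S : Fin T → Measure (X × Y))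
    [∀ t, IsProbabilityMeasure (S t)] (Q : Measure (X × Y)) {h : X → Y → ℝ} (hh : h ∈ H)
    (αhat : Fin T → Y → ℝ) (t : Fin T) {n : ℕ} (z : Fin n → X × Y) :
    ∫ p, labelRatio (S t) Q p.2 * ℓ (h p.1 p.2) ∂(S t) ≤
      empRisk z (αhat t) ℓ h +
        Lmax * (⨆ t, √(∑ y, (labelRatio (S t) Q y - αhat t y) ^ 2)) +
        uniformDev (S t) (weightedLoss (labelRatio (S t) Q) ℓ H) z := by
  have hbound : ∀ h p, |weightedLoss (labelRatio (S t) Q) ℓ H h p| ≤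
      (Lmax * ⨆ p : Fin T × Y, labelRatio (S p.1) Q p.2).toNNReal := fun h p => by
    obtain ⟨h0, hle⟩ := weightedLoss_bounds (labelRatio_bounds S Q t) hℓ H h p
    rw [abs_of_nonneg h0]
    exact hle.trans (Real.le_coe_toNNReal _)
  have hdev : (∫ p, labelRatio (S t) Q p.2 * ℓ (h p.1 p.2) ∂(S t)) -
      empRisk z (labelRatio (S t) Q) ℓ h ≤ _ :=
    integral_sub_average_le_uniformDev (S t) hbound z ⟨h, hh⟩
  have hestimate := empRisk_le_add z (labelRatio (S t) Q) (αhat t) hℓ h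
  have hsup := mul_le_mul_of_nonneg_left
    (le_ciSup (f := fun t => √(∑ y, (labelRatio (S t) Q y - αhat t y) ^ 2))
      (Set.finite_range _).bddAbove t) ((hℓ 0).1.trans (hℓ 0).2)
  linarith

variable [MetricSpace X] [SecondCountableTopology X] [BorelSpace X] [DecidableEq Y]
  [MeasurableSingletonClass Y] {S : Fin T → Measure (X × Y)} [∀ t, IsProbabilityMeasure (S t)]
  {Q : Measure (X × Y)} [IsProbabilityMeasure Q] {D : ℝ≥0} (hD : ∀ x y : X, dist x y ≤ D)
  (hSQ : ∀ t y, labelMass (S t) y = 0 → labelMass Q y = 0)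
  {L K : ℝ≥0} (hℓL : LipschitzWith L ℓ) (hH : ∀ h ∈ H, ∀ y, LipschitzWith K fun x => h x y)
  {C s δ : ℝ} (hs : 2 ≤ s) {N : Fin T → ℕ} {M : ℕ} {w : Fin T → ℝ}
  {z : (∀ t, Fin (N t) → X × Y) × (Fin M → X × Y)} (hz : IsTypical S Q ℓ H Lmax C s D δ w z)
  (hpos : ∀ y, 0 < labelMass Q y → 0 < classCount z.2 y ∧ ∀ t, 0 < classCount (z.1 t) y)
  {h : X → Y → ℝ} (hh : h ∈ H)

include hD hSQ hℓL hH hs hz hpos hh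

lemma IsTypical.risk_sub_integral_labelRatio_mul_le (t : Fin T) :
    risk Q ℓ h - ∫ p, labelRatio (S t) Q p.2 * ℓ (h p.1 p.2) ∂(S t) ≤
      L * K * (∑ y, ((classCount z.2 y : ℝ) / M) * empW1 z.2 (z.1 t) y) +
        L * K * ((⨆ p : Fin T × {y : Y // 0 < labelMass Q y},
            kappa (C + D * Fintype.card Y + 1) s D T (Fintype.card Y) δ
              (classCount (z.1 p.1) p.2) (classCount z.2 p.2)) +
          maxEmpW1 Q z.1 z.2 * √(Real.log (1 / δ) / (2 * M))) := by
  set Cmax := maxEmpW1 Q z.1 z.2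
  set κ := ⨆ p : Fin T × {y : Y // 0 < labelMass Q y},
    kappa (C + D * Fintype.card Y + 1) s D T (Fintype.card Y) δ
      (classCount (z.1 p.1) p.2) (classCount z.2 p.2)
  have hfm : Measurable fun p : X × Y => ℓ (h p.1 p.2) :=
    measurable_from_prod_countable_left fun y =>
      (hℓL.continuous.comp (hH h hh y).continuous).measurable
  have hfi : ∀ (R : Measure (X × Y)) [IsProbabilityMeasure R],
      Integrable (fun p => ℓ (h p.1 p.2)) R := fun R _ =>
    Integrable.of_bound hfm.aestronglyMeasurable Lmax
      (ae_of_all _ fun p => (abs_of_nonneg (hℓ _).1).trans_le (hℓ _).2)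
  have hclass : ∀ y, 0 < labelMass Q y → classDev (S t) (z.1 t) y + classDev Q z.2 y ≤
      κ - Cmax * (Fintype.card Y * (1 / √M)) := fun y hy => by
    obtain ⟨hQ, hS⟩ := hpos y hy
    have hcount : classCount z.2 y ≤ M := by
      simpa [classCount] using Finset.card_filter_le (Finset.univ : Finset (Fin M)) _
    have hkappa := kappa_add_le (C := C) hs D.coe_nonneg (maxEmpW1_le Q z.1 z.2 hD hpos) T
      (Fintype.card Y) δ (k := classCount (z.1 t) y) hQ hcount
    have hsup : _ ≤ κ := le_ciSup (Set.finite_range _).bddAbove (t, ⟨y, hy⟩)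
    rw [kappa_eq_classRadius_add] at hkappa
    linarith [hz.source_classDev_le t y (hS t), hz.target_classDev_le y hQ]
  have hgap := integral_sub_integral_labelRatio_mul_le hD (hSQ t) (K := L * K)
    (fun y => hℓL.comp (hH h hh y)) hfm (hfi (S t)) (hfi Q)
    (fun y hy => ⟨(hpos y hy).1, (hpos y hy).2 t⟩) (maxEmpW1_nonneg Q z.1 z.2)
    (fun y hy => empW1_le_maxEmpW1 Q z.1 z.2 t hy) hclass
  have hlabel := mul_le_mul_of_nonneg_left hz.labelDev_le (maxEmpW1_nonneg Q z.1 z.2)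
  rw [NNReal.coe_mul] at hgap
  refine hgap.trans (add_le_add le_rfl (mul_le_mul_of_nonneg_left ?_ (by positivity)))
  rw [mul_add] at hlabel
  linarith

theorem IsTypical.risk_le (hδ : 0 < δ) (hw : w ∈ stdSimplex ℝ (Fin T)) (αhat : Fin T → Y → ℝ) :
    risk Q ℓ h ≤
      ∑ t, w t * empRisk (z.1 t) (αhat t) ℓ h +
      Lmax * (⨆ p : Fin T × Y, labelRatio (S p.1) Q p.2) *
        √(∑ t, w t ^ 2 / ((N t : ℝ) / ∑ u, (N u : ℝ))) *
        √(Real.log (1 / δ) / (2 * ∑ u, (N u : ℝ))) +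
      L * K * ∑ t, w t * ∑ y, ((classCount z.2 y : ℝ) / M) * empW1 z.2 (z.1 t) y +
      Lmax * (⨆ t, √(∑ y, (labelRatio (S t) Q y - αhat t y) ^ 2)) +
      comp S Q ℓ H (L * K) (C + D * Fintype.card Y + 1) s D (maxEmpW1 Q z.1 z.2) N M
        (fun t y => classCount (z.1 t) y) (fun y => classCount z.2 y) δ := by
  have hT : (1 : ℝ) ≤ T := by
    exact_mod_cast Fin.pos_iff_nonempty.2 (nonempty_of_mem_stdSimplex hw)
  set κ := ⨆ p : Fin T × {y : Y // 0 < labelMass Q y},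
    kappa (C + D * Fintype.card Y + 1) s D T (Fintype.card Y) δ
      (classCount (z.1 p.1) p.2) (classCount z.2 p.2)
  have hsource : ∀ t, risk Q ℓ h ≤ empRisk (z.1 t) (αhat t) ℓ h +
      uniformDev (S t) (weightedLoss (labelRatio (S t) Q) ℓ H) (z.1 t) +
      L * K * (∑ y, ((classCount z.2 y : ℝ) / M) * empW1 z.2 (z.1 t) y) +
      (Lmax * (⨆ t, √(∑ y, (labelRatio (S t) Q y - αhat t y) ^ 2)) +
        L * K * (κ + maxEmpW1 Q z.1 z.2 * √(Real.log (1 / δ) / (2 * M)))) := fun t => by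
    linarith [hz.risk_sub_integral_labelRatio_mul_le hℓ hD hSQ hℓL hH hs hpos hh t,
      integral_labelRatio_mul_loss_le hℓ S Q hh αhat t (z.1 t)]
  have haverage := le_sum_mul_of_forall_le hw hsource
  simp only [mul_add (w _), Finset.sum_add_distrib, ← Finset.sum_mul, hw.2, one_mul,
    mul_left_comm (w _), ← Finset.mul_sum] at haverage
  have hrad := sum_mul_le_iSup hw fun t => rademacher (S t) (labelRatio (S t) Q) ℓ H (N t)
  have hlog : √(Real.log (1 / δ) / (2 * M)) ≤
      √(2 * Real.log (2 * Fintype.card Y) / M) + √(Real.log (T / δ) / (2 * M)) := by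
    refine le_add_of_nonneg_of_le (Real.sqrt_nonneg _) ?_
    gcongr
  have hcomp : L * K * (κ + maxEmpW1 Q z.1 z.2 * √(Real.log (1 / δ) / (2 * M))) ≤
      L * K * (κ + maxEmpW1 Q z.1 z.2 *
        (√(2 * Real.log (2 * Fintype.card Y) / M) + √(Real.log (T / δ) / (2 * M)))) := by
    have := maxEmpW1_nonneg Q z.1 z.2
    gcongr
  have hdev := hz.sum_uniformDev_le
  simp only [mul_left_comm (w _), ← Finset.mul_sum] at hdev
  change _ ≤ _ + (2 * _ + L * K * (κ + _))
  linarith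

end RiskBound

end LabelShift
end

open LabelShift in
theorem theorem1_general {X : Type*} [MetricSpace X] [MeasurableSpace X] [BorelSpace X]
    (hX : HasPolynomialCovering X) (D : ℝ≥0) (hD : ∀ x y : X, dist x y ≤ D)
    (Y : Type*) [Fintype Y] [DecidableEq Y] [MeasurableSpace Y] [MeasurableSingletonClass Y] :
    ∃ C s : ℝ, 0 < C ∧ 2 < s ∧
    ∀ (T : ℕ) (S : Fin T → Measure (X × Y)) (Q : Measure (X × Y))
      [∀ t, IsProbabilityMeasure (S t)] [IsProbabilityMeasure Q],
      (∀ t y, labelMass (S t) y = 0 → labelMass Q y = 0) →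
    ∀ (ℓ : ℝ → ℝ) (L K : ℝ≥0) (Lmax : ℝ) (H : Set (X → Y → ℝ)),
      LipschitzWith L ℓ → (∀ a, 0 ≤ ℓ a ∧ ℓ a ≤ Lmax) →
      (∀ h ∈ H, ∀ y, LipschitzWith K (fun x => h x y)) →
    ∀ δ : ℝ, 0 < δ → δ < 1 →
      (∀ (Cmax : ℝ) (N N' : Fin T → ℕ) (M M' : ℕ) (k k' : Fin T → Y → ℕ) (m m' : Y → ℕ),
        0 ≤ Cmax → (∀ t, 0 < N t) → 0 < M →
        (∀ y, 0 < labelMass Q y → 0 < m y ∧ ∀ t, 0 < k t y) →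
        N ≤ N' → M ≤ M' → k ≤ k' → m ≤ m' →
        comp S Q ℓ H (L * K) C s D Cmax N' M' k' m' δ ≤
          comp S Q ℓ H (L * K) C s D Cmax N M k m δ) ∧
      ∀ (N : Fin T → ℕ) (M : ℕ), (∀ t, 0 < N t) → 0 < M →
      ∀ w ∈ stdSimplex ℝ (Fin T),
        ∃ E : Set ((∀ t, Fin (N t) → X × Y) × (Fin M → X × Y)),
          MeasurableSet E ∧ 1 - 4 * δ ≤ (dataLaw S Q N M).real E ∧
          ∀ z ∈ E,
            (∀ y, 0 < labelMass Q y → 0 < classCount z.2 y ∧ ∀ t, 0 < classCount (z.1 t) y) →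
            ∀ h ∈ H, ∀ αhat : Fin T → Y → ℝ,
              risk Q ℓ h ≤
                ∑ t, w t * empRisk (z.1 t) (αhat t) ℓ h +
                Lmax * (⨆ p : Fin T × Y, labelRatio (S p.1) Q p.2) *
                  √(∑ t, w t ^ 2 / ((N t : ℝ) / ∑ u, (N u : ℝ))) *
                  √(Real.log (1 / δ) / (2 * ∑ u, (N u : ℝ))) +
                L * K * ∑ t, w t * ∑ y, ((classCount z.2 y : ℝ) / M) * empW1 z.2 (z.1 t) y +
                Lmax * (⨆ t, √(∑ y, (labelRatio (S t) Q y - αhat t y) ^ 2)) +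
                comp S Q ℓ H (L * K) C s D (maxEmpW1 Q z.1 z.2) N M
                  (fun t y => classCount (z.1 t) y) (fun y => classCount z.2 y) δ := by
  have := hX.secondCountableTopology
  obtain ⟨C, s, hC, hs, hrate⟩ := hX.exists_hasLipDevRate
  refine ⟨C + D * Fintype.card Y + 1, s, by positivity, hs, ?_⟩
  intro T S Q _ _ hSQ ℓ L K Lmax H hℓL hℓ hH δ hδ _
  have hHc : ∀ h ∈ H, ∀ y, Continuous fun x => h x y := fun h hh y => (hH h hh y).continuous
  refine ⟨fun Cmax N N' M M' k k' m m' hCmax hN hM hpos hNN' hMM' hk hm => ?_,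
    fun N M hN hM w hw => ?_⟩
  · exact comp_le_comp (by positivity) (by positivity) (by linarith) D.coe_nonneg hCmax
      (fun t => rademacher_antitoneOn hℓL.continuous hℓ hHc (S t)
        (labelRatio_bounds S Q t) (hN t) ((hN t).trans_le (hNN' t)) (hNN' t))
      hM hpos hMM' hk hm
  · have hT : 0 < T := Fin.pos_iff_nonempty.2 (nonempty_of_mem_stdSimplex hw)
    have htypical := measureReal_not_isTypical_le S Q hD hrate hδ hT hN hM
      hℓL.continuous hℓ hHc hw.1
    obtain ⟨E, hE, hPE, hEtypical⟩ := exists_measurableSet_of_measureReal_le _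
      (htypical.trans (by linarith : 3 * δ ≤ 4 * δ))
    exact ⟨E, hE, hPE, fun z hz hpos h hh αhat =>
      (hEtypical z hz).risk_le hℓ hD hSQ hℓL hH hs.le hpos hh hδ hw αhat⟩

theorem theorem1 {d : ℕ} (X : Set (EuclideanSpace ℝ (Fin d))) (hX : Bornology.IsBounded X)
    (Y : Type*) [Fintype Y] [DecidableEq Y] [MeasurableSpace Y] [MeasurableSingletonClass Y] :
    -- the constants depend on the input space and the label space only
    ∃ C s : ℝ, 0 < C ∧ 2 < s ∧
    ∀ (T : ℕ) (S : Fin T → Measure (X × Y)) (Q : Measure (X × Y))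
      [∀ t, IsProbabilityMeasure (S t)] [IsProbabilityMeasure Q],
      -- the ratios `Q(y) / S t (y)` are finite
      (∀ t y, LabelShift.labelMass (S t) y = 0 → LabelShift.labelMass Q y = 0) →
    ∀ (ℓ : ℝ → ℝ) (L K : ℝ≥0) (Lmax : ℝ) (H : Set (X → Y → ℝ)),
      LipschitzWith L ℓ → (∀ a, 0 ≤ ℓ a ∧ ℓ a ≤ Lmax) →
      (∀ h ∈ H, ∀ y, LipschitzWith K (fun x => h x y)) →
    ∀ δ : ℝ, 0 < δ → δ < 1 →
      -- the complexity term decreases when the sample sizes grow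
      (∀ (Cmax : ℝ) (N N' : Fin T → ℕ) (M M' : ℕ) (k k' : Fin T → Y → ℕ) (m m' : Y → ℕ),
        0 ≤ Cmax → (∀ t, 0 < N t) → 0 < M →
        (∀ y, 0 < LabelShift.labelMass Q y → 0 < m y ∧ ∀ t, 0 < k t y) →
        N ≤ N' → M ≤ M' → k ≤ k' → m ≤ m' →
        LabelShift.comp S Q ℓ H (L * K) C s (Metric.diam X) Cmax N' M' k' m' δ ≤
          LabelShift.comp S Q ℓ H (L * K) C s (Metric.diam X) Cmax N M k m δ) ∧
      -- the bound on the target risk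
      ∀ (N : Fin T → ℕ) (M : ℕ), (∀ t, 0 < N t) → 0 < M →
      ∀ w ∈ stdSimplex ℝ (Fin T),
        ∃ E : Set ((∀ t, Fin (N t) → X × Y) × (Fin M → X × Y)),
          MeasurableSet E ∧ 1 - 4 * δ ≤ (LabelShift.dataLaw S Q N M).real E ∧
          ∀ z ∈ E,
            -- every class of the target occurs in each sample; otherwise `κ` is infinite
            (∀ y, 0 < LabelShift.labelMass Q y →
              0 < LabelShift.classCount z.2 y ∧ ∀ t, 0 < LabelShift.classCount (z.1 t) y) →
            ∀ h ∈ H, ∀ αhat : Fin T → Y → ℝ,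
              LabelShift.risk Q ℓ h ≤
                ∑ t, w t * LabelShift.empRisk (z.1 t) (αhat t) ℓ h +
                Lmax * (⨆ p : Fin T × Y, LabelShift.labelRatio (S p.1) Q p.2) *
                  √(∑ t, w t ^ 2 / ((N t : ℝ) / ∑ u, (N u : ℝ))) *
                  √(Real.log (1 / δ) / (2 * ∑ u, (N u : ℝ))) +
                L * K * ∑ t, w t * ∑ y,
                  ((LabelShift.classCount z.2 y : ℝ) / M) * LabelShift.empW1 z.2 (z.1 t) y +
                Lmax * (⨆ t, √(∑ y, (LabelShift.labelRatio (S t) Q y - αhat t y) ^ 2)) +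
                LabelShift.comp S Q ℓ H (L * K) C s (Metric.diam X)
                  (LabelShift.maxEmpW1 Q z.1 z.2) N M
                  (fun t y => LabelShift.classCount (z.1 t) y)
                  (fun y => LabelShift.classCount z.2 y) δ :=
  theorem1_general (LabelShift.hasPolynomialCovering_of_isBounded hX)
    ⟨Metric.diam X, Metric.diam_nonneg⟩ (fun x y => Metric.dist_le_diam_of_mem hX x.2 y.2) Y
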